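/- Let $R$ be a left coherent ring (associative, with unit, not necessarily commutative), i.e. every finitely generated left ideal of $R$ is finitely presented, and let $M$, $N$ be finitely presented left $R$-modules. Let $\mathbf{K}^{-,b}(R\text{-proj})$ be the homotopy category of bounded-above complexes of finitely generated projective left $R$-modules with bounded cohomology, let $\mathbf{K}^{b}(R\text{-proj})$ be its full triangulated subcategory of bounded complexes, and let $\mathbf{D}_{\rm sg}(R)=\mathbf{K}^{-,b}(R\text{-proj})/\mathbf{K}^{b}(R\text{-proj})$ be the Verdier quotient. Let $\Sigma$ denote the shift functor. Then $M$ and $N$ admit projective resolutions by finitely generated projective modules. Let $P$ and $Q$ be any such resolutions of $M$ and $N$, regarded as complexes in non-positive cohomological degrees; $M$ and $N$ are identified with $P$ and $Q$ and thereby viewed as objects of $\mathbf{K}^{-,b}(R\text{-proj})$ and of $\mathbf{D}_{\rm sg}(R)$. Write $M^\vee=\mathbb{R}\mathrm{Hom}_R(M,R)$, the complex of right $R$-modules $P^*=\mathrm{Hom}_R(P,R)$, and for $i\in\mathbb{Z}$ let $\mathrm{Tor}^R_i(M^\vee,N)=H^{-i}(P^*\otimes_R Q)$. For $n\in\mathbb{Z}$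 let $\mathrm{Ext}^n_R(M,N)=\mathrm{Hom}_{\mathbf{D}(R\text{-Mod})}(M,\Sigma^nN)$, which is the usual Ext group for $n\ge 0$ and is $0$ for $n<0$. Then there are homomorphisms, for all $n\in\mathbb{Z}$, forming a long exact sequence of abelian groups $$\cdots\to \mathrm{Tor}^R_{-n}(M^\vee,N)\to \mathrm{Ext}^n_R(M,N)\to \mathrm{Hom}_{\mathbf{D}_{\rm sg}(R)}(M,\Sigma^nN)\to \mathrm{Tor}^R_{-n-1}(M^\vee,N)\to \mathrm{Ext}^{n+1}_R(M,N)\to\cdots$$ in which the map $\mathrm{Ext}^n_R(M,N)\to \mathrm{Hom}_{\mathbf{D}_{\rm sg}(R)}(M,\Sigma^nN)$ is induced by the quotient functor: composed with the canonical map $\mathrm{Hom}_{\mathbf{K}^{-,b}(R\text{-proj})}(P,\Sigma^nQ)\to\mathrm{Ext}^n_R(M,N)$, it is the map given by $\mathbf{K}^{-,b}(R\text{-proj})\to\mathbf{D}_{\rm sg}(R)$. Consequently, for every $n\le -2$, the map $$\mathrm{Hom}_{\mathbf{D}_{\rm sg}(R)}(M,\Sigma^nN)\to \mathrm{Tor}^R_{-(n+1)}(M^\vee,N)$$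 of this sequence is an isomorphism. -/

import Mathlib

universe w u

open CategoryTheory Limits
open scoped ZeroObject

noncomputable section

namespace SingularityCategory

/-- A ring is left coherent if every finitely generated left ideal is finitely presented. -/
def IsLeftCoherent (R : Type u) [Ring R] : Prop :=
  ∀ I : Ideal R, I.FG → Module.FinitePresentation R I

variable (R : Type u) [Ring R]

/-! ### Homotopy categories of complexes of finitely generated projective modules

A complex in `R-proj` is a complex of left `R`-modules all of whose terms are finitely generated
projective; as `R-proj` is a full subcategory of `R-Mod`, the category `K(R-proj)` is a full
subcategory of `K(R-Mod)`. -/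

variable {R} in
/-- All the terms of the complex are finitely generated projective. -/
def IsFGProj (K : CochainComplex (ModuleCat.{u} R) ℤ) : Prop :=
  ∀ i, Module.Finite R (K.X i) ∧ Module.Projective R (K.X i)

/-- The objects of `K⁻(R-proj)`: bounded above complexes in `R-proj`. -/
def kMinus : ObjectProperty (HomotopyCategory (ModuleCat.{u} R) (.up ℤ)) :=
  fun K => IsFGProj K.as ∧ ∃ n : ℤ, CochainComplex.IsStrictlyLE K.as n

/-- The objects of `Kᵇ(R-proj)`: bounded complexes in `R-proj`. -/
def kBounded : ObjectProperty (HomotopyCategory (ModuleCat.{u} R) (.up ℤ)) :=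
  fun K => IsFGProj K.as ∧ ∃ m n : ℤ, CochainComplex.IsStrictlyGE K.as m ∧ CochainComplex.IsStrictlyLE K.as n

/-- Complexes whose cohomology vanishes in all degrees `< m` for some `m`. -/
def cohomologyBoundedBelow : ObjectProperty (HomotopyCategory (ModuleCat.{u} R) (.up ℤ)) :=
  fun K => ∃ m : ℤ, CochainComplex.IsGE K.as m

/-- The objects of `K^{-,b}(R-proj)`: bounded above complexes in `R-proj` with bounded cohomology.
(The cohomology of a bounded above complex is bounded above.) -/
def kMinusB : ObjectProperty (HomotopyCategory (ModuleCat.{u} R) (.up ℤ)) :=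
  kMinus R ⊓ cohomologyBoundedBelow R

section

variable {R}

lemma IsFGProj.shift {K : CochainComplex (ModuleCat.{u} R) ℤ} (hK : IsFGProj K) (n : ℤ) :
    IsFGProj (K⟦n⟧) :=
  fun i => hK (i + n)

lemma IsFGProj.zero : IsFGProj (0 : CochainComplex (ModuleCat.{u} R) ℤ) := fun i => by
  have : Subsingleton ((0 : CochainComplex (ModuleCat.{u} R) ℤ).X i) :=
    ModuleCat.subsingleton_of_isZero
      ((HomologicalComplex.eval (ModuleCat.{u} R) (.up ℤ) i).map_isZero (isZero_zero _))
  exact ⟨inferInstance, inferInstance⟩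

lemma IsFGProj.mappingCone {K L : CochainComplex (ModuleCat.{u} R) ℤ} (hK : IsFGProj K)
    (hL : IsFGProj L) (f : K ⟶ L) : IsFGProj (CochainComplex.mappingCone f) := fun i => by
  have e₁ : (CochainComplex.mappingCone f).X i ≅ K.X (i + 1) ⊞ L.X i :=
    HomologicalComplex.homotopyCofiber.XIsoBiprod f i (i + 1) rfl
  have e : (CochainComplex.mappingCone f).X i ≅ ModuleCat.of R (K.X (i + 1) × L.X i) :=
    e₁ ≪≫ ModuleCat.biprodIsoProd _ _
  have := (hK (i + 1)).1
  have := (hK (i + 1)).2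
  have := (hL i).1
  have := (hL i).2
  exact ⟨Module.Finite.equiv e.symm.toLinearEquiv, Module.Projective.of_equiv e.symm.toLinearEquiv⟩

lemma isStrictlyLE_mappingCone {K L : CochainComplex (ModuleCat.{u} R) ℤ} (f : K ⟶ L)
    (n₁ n₂ n : ℤ) [K.IsStrictlyLE n₁] [L.IsStrictlyLE n₂] (hn₁ : n₁ ≤ n) (hn₂ : n₂ ≤ n) :
    (CochainComplex.mappingCone f).IsStrictlyLE n := by
  rw [CochainComplex.isStrictlyLE_iff]
  intro i hi
  simp only [CochainComplex.mappingCone.isZero_X_iff]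
  exact ⟨K.isZero_of_isStrictlyLE n₁ _, L.isZero_of_isStrictlyLE n₂ _⟩

/-- In a distinguished triangle, the third object is isomorphic to the mapping cone. -/
def coneIso (T : Pretriangulated.Triangle (HomotopyCategory (ModuleCat.{u} R) (.up ℤ)))
    (hT : T ∈ Pretriangulated.distinguishedTriangles) (f : T.obj₁.as ⟶ T.obj₂.as)
    (hf : (HomotopyCategory.quotient _ _).map f = T.mor₁) :
    T.obj₃ ≅ (HomotopyCategory.quotient _ _).obj (CochainComplex.mappingCone f) :=
  Pretriangulated.Triangle.π₃.mapIso (Pretriangulated.isoTriangleOfIso₁₂ T _ hT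
    (HomotopyCategory.mappingCone_triangleh_distinguished f)
    (Iso.refl _) (Iso.refl _)
    ((Category.comp_id _).trans (hf.symm.trans (Category.id_comp _).symm)))

end

instance : (kMinus R).ContainsZero where
  exists_zero := ⟨(HomotopyCategory.quotient _ _).obj 0, Functor.map_isZero _ (isZero_zero _),
    IsFGProj.zero, 0, inferInstanceAs ((0 : CochainComplex (ModuleCat.{u} R) ℤ).IsStrictlyLE 0)⟩

instance : (kMinus R).IsStableUnderShift ℤ where
  isStableUnderShiftBy a :=
    { le_shift := by
        intro K hK
        obtain ⟨K : CochainComplex _ _, rfl⟩ := K.quotient_obj_surjective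
        obtain ⟨h, n, hn⟩ := hK
        change K.IsStrictlyLE n at hn
        rw [ObjectProperty.prop_shift_iff, HomotopyCategory.shift_quotient_obj]
        exact ⟨IsFGProj.shift h a, n - a,
          CochainComplex.isStrictlyLE_shift K n a (n - a) (by lia)⟩ }

instance : (kMinus R).IsTriangulatedClosed₃ where
  ext₃' := by
    rintro T hT ⟨h₁, n₁, hn₁⟩ ⟨h₂, n₂, hn₂⟩
    obtain ⟨f : T.obj₁.as ⟶ T.obj₂.as, hf⟩ := (HomotopyCategory.quotient _ _).map_surjective T.mor₁
    exact ⟨(HomotopyCategory.quotient _ _).obj (CochainComplex.mappingCone f),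
      ⟨h₁.mappingCone h₂ f, max n₁ n₂,
        isStrictlyLE_mappingCone f n₁ n₂ _ (le_max_left _ _) (le_max_right _ _)⟩,
      ⟨coneIso T hT f hf⟩⟩

instance : (kMinus R).IsTriangulated where
  toIsTriangulatedClosed₂ := .of_isTriangulatedClosed₃

instance : (kBounded R).ContainsZero where
  exists_zero := ⟨(HomotopyCategory.quotient _ _).obj 0, Functor.map_isZero _ (isZero_zero _),
    IsFGProj.zero, 0, 0,
    inferInstanceAs ((0 : CochainComplex (ModuleCat.{u} R) ℤ).IsStrictlyGE 0),
    inferInstanceAs ((0 : CochainComplex (ModuleCat.{u} R) ℤ).IsStrictlyLE 0)⟩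

instance : (kBounded R).IsStableUnderShift ℤ where
  isStableUnderShiftBy a :=
    { le_shift := by
        intro K hK
        obtain ⟨K : CochainComplex _ _, rfl⟩ := K.quotient_obj_surjective
        obtain ⟨h, m, n, hm, hn⟩ := hK
        change K.IsStrictlyGE m at hm
        change K.IsStrictlyLE n at hn
        rw [ObjectProperty.prop_shift_iff, HomotopyCategory.shift_quotient_obj]
        exact ⟨IsFGProj.shift h a, m - a, n - a,
          CochainComplex.isStrictlyGE_shift K m a (m - a) (by lia),
          CochainComplex.isStrictlyLE_shift K n a (n - a) (by lia)⟩ }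

instance : (kBounded R).IsTriangulatedClosed₃ where
  ext₃' := by
    rintro T hT ⟨h₁, m₁, n₁, hm₁, hn₁⟩ ⟨h₂, m₂, n₂, hm₂, hn₂⟩
    obtain ⟨f : T.obj₁.as ⟶ T.obj₂.as, hf⟩ := (HomotopyCategory.quotient _ _).map_surjective T.mor₁
    exact ⟨(HomotopyCategory.quotient _ _).obj (CochainComplex.mappingCone f),
      ⟨h₁.mappingCone h₂ f, min (m₁ - 1) m₂, max n₁ n₂,
        CochainComplex.isStrictlyGE_mappingCone f m₁ m₂ _ (by grind) (by grind),
        isStrictlyLE_mappingCone f n₁ n₂ _ (le_max_left _ _) (le_max_right _ _)⟩,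
      ⟨coneIso T hT f hf⟩⟩

instance : (kBounded R).IsTriangulated where
  toIsTriangulatedClosed₂ := .of_isTriangulatedClosed₃

lemma cohomologyBoundedBelow_eq [HasDerivedCategory.{w} (ModuleCat.{u} R)] :
    cohomologyBoundedBelow R =
      (DerivedCategory.TStructure.t (C := ModuleCat.{u} R)).plus.inverseImage
        DerivedCategory.Qh := by
  ext K
  exact exists_congr fun m => (DerivedCategory.isGE_Q_obj_iff K.as m).symm

instance : (cohomologyBoundedBelow R).IsTriangulated := by
  let := HasDerivedCategory.standard (ModuleCat.{u} R)
  rw [cohomologyBoundedBelow_eq]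
  infer_instance

instance : (cohomologyBoundedBelow R).IsClosedUnderIsomorphisms := by
  let := HasDerivedCategory.standard (ModuleCat.{u} R)
  rw [cohomologyBoundedBelow_eq]
  infer_instance

instance : (kMinusB R).IsTriangulated :=
  inferInstanceAs (kMinus R ⊓ cohomologyBoundedBelow R).IsTriangulated

/-- The triangulated category `K^{-,b}(R-proj)`. -/
abbrev KMinusB : Type (u + 1) := (kMinusB R).FullSubcategory

/-- The full triangulated subcategory of `K^{-,b}(R-proj)` given by `Kᵇ(R-proj)`
(closed up under isomorphisms, that is, under homotopy equivalences). -/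
def perfect : ObjectProperty (KMinusB R) :=
  (kBounded R).isoClosure.inverseImage (kMinusB R).ι

instance : (perfect R).IsTriangulated :=
  inferInstanceAs ((kBounded R).isoClosure.inverseImage (kMinusB R).ι).IsTriangulated

/-- The singularity category `D_sg(R)`: the Verdier quotient of `K^{-,b}(R-proj)` by
`Kᵇ(R-proj)`, that is, the localization at the morphisms whose cone is in `Kᵇ(R-proj)`. -/
abbrev DSing := (perfect R).trW.Localization

/-- The quotient functor `K^{-,b}(R-proj) ⥤ D_sg(R)`. -/
abbrev quotientFunctor : KMinusB R ⥤ DSing R := (perfect R).trW.Q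

/-- The triangle functor `K^{-,b}(R-proj) ⥤ D(R-Mod)`; it identifies `K^{-,b}(R-proj)` with
`Dᵇ(R-mod)` when `R` is left coherent. -/
abbrev toDerived [HasDerivedCategory.{w} (ModuleCat.{u} R)] :
    KMinusB R ⥤ DerivedCategory (ModuleCat.{u} R) :=
  (kMinusB R).ι ⋙ DerivedCategory.Qh

/-! ### Modules as objects of the singularity category -/

variable {R}

/-- A projective resolution of `M` by finitely generated projective modules. -/
structure FGProjectiveResolution (M : ModuleCat.{u} R) extends ProjectiveResolution M where
  finite (n : ℕ) : Module.Finite R (complex.X n)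

namespace FGProjectiveResolution

variable {M N : ModuleCat.{u} R}

lemma isFGProj (P : FGProjectiveResolution M) :
    IsFGProj P.toProjectiveResolution.cochainComplex := fun i => by
  constructor
  · by_cases hi : i ≤ 0
    · obtain ⟨k, rfl⟩ := Int.exists_eq_neg_ofNat hi
      have := P.finite k
      exact Module.Finite.equiv
        (P.toProjectiveResolution.cochainComplexXIso (-k) k).symm.toLinearEquiv
    · have : Subsingleton (P.toProjectiveResolution.cochainComplex.X i) :=
        ModuleCat.subsingleton_of_isZero (CochainComplex.isZero_of_isStrictlyLE _ 0 _)
      infer_instance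
  · exact (IsProjective.iff_projective (R := R) _).2
      (inferInstanceAs (Projective (P.toProjectiveResolution.cochainComplex.X i)))

/-- The module `M`, identified with its projective resolution `P`, as an object of
`K^{-,b}(R-proj)`. -/
def toKMinusB (P : FGProjectiveResolution M) : KMinusB R where
  obj := (HomotopyCategory.quotient _ _).obj P.toProjectiveResolution.cochainComplex
  property := ⟨⟨P.isFGProj,
      0, inferInstanceAs (P.toProjectiveResolution.cochainComplex.IsStrictlyLE 0)⟩,
    0, inferInstanceAs (P.toProjectiveResolution.cochainComplex.IsGE 0)⟩

/-- The module `M` as an object of `D_sg(R)`. -/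
abbrev toDSing (P : FGProjectiveResolution M) : DSing R := (quotientFunctor R).obj P.toKMinusB

/-- The augmentation, as an isomorphism from `P` to `M` (in degree `0`) in `D(R-Mod)`. -/
def augmentation [HasDerivedCategory.{w} (ModuleCat.{u} R)] (P : FGProjectiveResolution M) :
    (toDerived R).obj P.toKMinusB ≅ (DerivedCategory.singleFunctor (ModuleCat.{u} R) 0).obj M :=
  (DerivedCategory.quotientCompQhIso _).app P.toProjectiveResolution.cochainComplex ≪≫
    asIso (DerivedCategory.Q.map P.toProjectiveResolution.π') ≪≫
    ((DerivedCategory.singleFunctorIsoCompQ (ModuleCat.{u} R) 0).app M).symm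

end FGProjectiveResolution

/-! ### Ext groups -/

/-- `Extⁿ_R(M, N)` for `n : ℤ`, as the group of morphisms `M ⟶ Σⁿ N` in `D(R-Mod)`. -/
abbrev ExtGroup [HasDerivedCategory.{w} (ModuleCat.{u} R)] (M N : ModuleCat.{u} R) (n : ℤ) :
    Type w :=
  ShiftedHom ((DerivedCategory.singleFunctor (ModuleCat.{u} R) 0).obj M)
    ((DerivedCategory.singleFunctor (ModuleCat.{u} R) 0).obj N) n

/-- For `n ≥ 0` this agrees with the usual Ext groups. -/
def extGroupEquiv [HasDerivedCategory.{w} (ModuleCat.{u} R)] (M N : ModuleCat.{u} R) (n : ℕ) :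
    Abelian.Ext M N n ≃+ ExtGroup M N n :=
  Abelian.Ext.homAddEquiv

/-- For `n < 0` the group `Extⁿ_R(M, N)` is zero. -/
lemma subsingleton_extGroup [HasDerivedCategory.{w} (ModuleCat.{u} R)] (M N : ModuleCat.{u} R)
    {n : ℤ} (hn : n < 0) : Subsingleton (ExtGroup M N n) :=
  ⟨fun f g => by
    have h (f : ExtGroup M N n) : f = 0 :=
      (DerivedCategory.TStructure.t (C := ModuleCat.{u} R)).zero_of_isLE_of_isGE f 0 (-n)
        (by lia) inferInstance
        ((DerivedCategory.TStructure.t (C := ModuleCat.{u} R)).isGE_shift _ 0 n (-n))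
    rw [h f, h g]⟩

/-- For resolutions `P` of `M` and `Q` of `N`, the canonical map
`Hom_{K^{-,b}(R-proj)}(P, Σⁿ Q) → Extⁿ_R(M, N)`. -/
def toExtGroup [HasDerivedCategory.{w} (ModuleCat.{u} R)] {M N : ModuleCat.{u} R}
    (P : FGProjectiveResolution M) (Q : FGProjectiveResolution N) {n : ℤ}
    (f : ShiftedHom P.toKMinusB Q.toKMinusB n) : ExtGroup M N n :=
  P.augmentation.inv ≫ f.map (toDerived R) ≫ Q.augmentation.hom⟦n⟧'

/-! ### Tensor products over a noncommutative ring, and hyper-Tor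

Right `R`-modules are modules over `Rᵐᵒᵖ`. -/

open scoped TensorProduct

section Tensor

variable (R)

/-- The relations `(a r) ⊗ b = a ⊗ (r b)`. -/
def balancedRelations (A B : Type u) [AddCommGroup A] [Module Rᵐᵒᵖ A] [AddCommGroup B]
    [Module R B] : AddSubgroup (A ⊗[ℤ] B) :=
  AddSubgroup.closure {x | ∃ (a : A) (r : R) (b : B),
    x = (MulOpposite.op r • a) ⊗ₜ[ℤ] b - a ⊗ₜ[ℤ] (r • b)}

/-- The tensor product `A ⊗_R B` of a right module and a left module over `R`. -/
abbrev BalancedTensor (A B : Type u) [AddCommGroup A] [Module Rᵐᵒᵖ A] [AddCommGroup B]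
    [Module R B] : Type u :=
  (A ⊗[ℤ] B) ⧸ balancedRelations R A B

variable {A A' B B' : Type u} [AddCommGroup A] [Module Rᵐᵒᵖ A] [AddCommGroup B]
  [Module R B] [AddCommGroup A'] [Module Rᵐᵒᵖ A'] [AddCommGroup B'] [Module R B']

/-- The map `f ⊗ g : A ⊗_R B → A' ⊗_R B'`. -/
def BalancedTensor.map (f : A →ₗ[Rᵐᵒᵖ] A') (g : B →ₗ[R] B') :
    BalancedTensor R A B →+ BalancedTensor R A' B' :=
  QuotientAddGroup.map _ _
    (TensorProduct.map f.toAddMonoidHom.toIntLinearMap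
      g.toAddMonoidHom.toIntLinearMap).toAddMonoidHom (by
    rw [balancedRelations, AddSubgroup.closure_le]
    rintro _ ⟨a, r, b, rfl⟩
    refine AddSubgroup.subset_closure ⟨f a, r, g b, ?_⟩
    simp)

/-- The class `a ⊗ b`. -/
abbrev BalancedTensor.tmul (a : A) (b : B) : BalancedTensor R A B :=
  QuotientAddGroup.mk (a ⊗ₜ[ℤ] b)

lemma BalancedTensor.hom_ext {C : Type*} [AddCommGroup C] {f g : BalancedTensor R A B →+ C}
    (h : ∀ a b, f (tmul R a b) = g (tmul R a b)) : f = g := by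
  refine QuotientAddGroup.addMonoidHom_ext _ (AddMonoidHom.ext fun x => ?_)
  induction x with
  | zero => simp only [map_zero]
  | tmul a b => exact h a b
  | add x y hx hy => simp only [map_add, hx, hy]

lemma BalancedTensor.map_tmul (f : A →ₗ[Rᵐᵒᵖ] A') (g : B →ₗ[R] B') (a : A) (b : B) :
    map R f g (tmul R a b) = tmul R (f a) (g b) := rfl

/-- The bifunctor `(A, B) ↦ A ⊗_R B` to abelian groups. -/
def tensorBifunctor : ModuleCat.{u} Rᵐᵒᵖ ⥤ ModuleCat.{u} R ⥤ AddCommGrpCat.{u} where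
  obj A :=
    { obj := fun B => AddCommGrpCat.of (BalancedTensor R A B)
      map := fun g => AddCommGrpCat.ofHom (BalancedTensor.map R LinearMap.id g.hom)
      map_id := fun _ => AddCommGrpCat.hom_ext (BalancedTensor.hom_ext R fun _ _ => rfl)
      map_comp := fun _ _ => AddCommGrpCat.hom_ext (BalancedTensor.hom_ext R fun _ _ => rfl) }
  map f :=
    { app := fun _ => AddCommGrpCat.ofHom (BalancedTensor.map R f.hom LinearMap.id)
      naturality := fun _ _ _ => AddCommGrpCat.hom_ext (BalancedTensor.hom_ext R fun _ _ => rfl) }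
  map_id _ := NatTrans.ext (funext fun _ =>
    AddCommGrpCat.hom_ext (BalancedTensor.hom_ext R fun _ _ => rfl))
  map_comp _ _ := NatTrans.ext (funext fun _ =>
    AddCommGrpCat.hom_ext (BalancedTensor.hom_ext R fun _ _ => rfl))

instance : (tensorBifunctor R).Additive where
  map_add := NatTrans.ext (funext fun _ => AddCommGrpCat.hom_ext
    (BalancedTensor.hom_ext R fun _ _ =>
      congr_arg QuotientAddGroup.mk (TensorProduct.add_tmul _ _ _)))

instance (A : ModuleCat.{u} Rᵐᵒᵖ) : ((tensorBifunctor R).obj A).Additive where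
  map_add := AddCommGrpCat.hom_ext (BalancedTensor.hom_ext R fun _ _ =>
    congr_arg QuotientAddGroup.mk (TensorProduct.tmul_add _ _ _))

end Tensor

/-- Precomposition `Hom_R(B', R) → Hom_R(B, R)` with `g : B → B'`, as a map of right modules. -/
def dualMap {B B' : ModuleCat.{u} R} (g : B ⟶ B') :
    ModuleCat.of Rᵐᵒᵖ (B' →ₗ[R] R) ⟶ ModuleCat.of Rᵐᵒᵖ (B →ₗ[R] R) :=
  ModuleCat.ofHom
    { toFun := fun φ => φ ∘ₗ g.hom
      map_add' := fun _ _ => rfl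
      map_smul' := fun _ _ => rfl }

/-- The dual complex `K^* = Hom_R(K, R)` of right modules, with `(K^*)ⁿ = Hom_R(K⁻ⁿ, R)` and
`d φ = -(-1)ⁿ φ ∘ d` for `φ` of degree `n`. If `K` is a projective resolution of `M`, then `K^*`
is the complex `M^∨ = ℝHom_R(M, R)`. -/
def dualComplex (K : CochainComplex (ModuleCat.{u} R) ℤ) :
    CochainComplex (ModuleCat.{u} Rᵐᵒᵖ) ℤ where
  X n := ModuleCat.of Rᵐᵒᵖ (K.X (-n) →ₗ[R] R)
  d m n := n.negOnePow • dualMap (K.d (-n) (-m))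
  shape m n h := by
    rw [K.shape (-n) (-m) (fun h' => h (by simp only [ComplexShape.up_Rel] at h' ⊢; lia))]
    have : dualMap (0 : K.X (-n) ⟶ K.X (-m)) = 0 :=
      ModuleCat.hom_ext (LinearMap.ext fun φ => LinearMap.comp_zero φ)
    rw [this, smul_zero]
  d_comp_d' l m n _ _ := by
    have : dualMap (K.d (-m) (-l)) ≫ dualMap (K.d (-n) (-m)) =
        dualMap (K.d (-n) (-m) ≫ K.d (-m) (-l)) := rfl
    rw [Linear.units_smul_comp, Linear.comp_units_smul, this, K.d_comp_d]
    have : dualMap (0 : K.X (-n) ⟶ K.X (-l)) = 0 :=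
      ModuleCat.hom_ext (LinearMap.ext fun φ => LinearMap.comp_zero φ)
    rw [this, smul_zero, smul_zero]

/-- The total tensor product complex `X ⊗_R Y` of a complex of right modules and a complex of
left modules, with the usual differential `d (x ⊗ y) = d x ⊗ y + (-1)^|x| x ⊗ d y`. -/
def tensorComplex (X : CochainComplex (ModuleCat.{u} Rᵐᵒᵖ) ℤ)
    (Y : CochainComplex (ModuleCat.{u} R) ℤ) : CochainComplex AddCommGrpCat.{u} ℤ :=
  HomologicalComplex.mapBifunctor X Y (tensorBifunctor R) (.up ℤ)

/-- The hyper-Tor group `Tor^R_i(X, N) = H⁻ⁱ(X ⊗_R Q)` of a complex `X` of right modules and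
a module `N` with projective resolution `Q`. -/
def hyperTor (X : CochainComplex (ModuleCat.{u} Rᵐᵒᵖ) ℤ) {N : ModuleCat.{u} R}
    (Q : FGProjectiveResolution N) (i : ℤ) : Type u :=
  (tensorComplex X Q.toProjectiveResolution.cochainComplex).homology (-i)

instance (X : CochainComplex (ModuleCat.{u} Rᵐᵒᵖ) ℤ) {N : ModuleCat.{u} R}
    (Q : FGProjectiveResolution N) (i : ℤ) : AddCommGroup (hyperTor X Q i) :=
  inferInstanceAs (AddCommGroup
    ((tensorComplex X Q.toProjectiveResolution.cochainComplex).homology (-i)))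

/-- The complex `M^∨ = ℝHom_R(M, R)`, computed by the resolution `P` of `M`. -/
abbrev FGProjectiveResolution.rhomDual {M : ModuleCat.{u} R} (P : FGProjectiveResolution M) :
    CochainComplex (ModuleCat.{u} Rᵐᵒᵖ) ℤ :=
  dualComplex P.toProjectiveResolution.cochainComplex

end SingularityCategory

end

noncomputable section

namespace SingularityCategory

/-! Everything takes place in the complex Hom(P, Q), whose cochains of degree n are families of maps
P^p → Q^(p+n). Call a cochain bounded if its components into Q^q vanish for all q below some bound;
these form a subcomplex. As P is bounded above, a bounded cochain has only finitely many nonzero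
components, and as each P^p is finitely generated projective, Hom(P^p, R) ⊗ Q^q = Hom(P^p, Q^q). Up
to the sign (-1)^(ab) this identifies P^* ⊗ Q with the bounded cochains
(`exists_boundedCocycle_toHomology`). The cohomology of the whole of Hom(P, Q) is Hom in
K^{-,b}(R-proj), which is Ext because P is K-projective.

It remains to see that the quotient of Hom(P, Q) by the bounded cochains computes Hom in D_sg. A map
from a bounded complex to Σⁿ Q dies in Σⁿ of the stupid truncation σ_{<k} Q once k is small, so
these truncations are cofinal among maps out of Q with perfect cone. Hence Hom_{D_sg}(P, Σⁿ Q) is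
the colimit over k → -∞ of Hom_K(P, Σⁿ σ_{<k} Q), and a cochain into Q that is a cocycle modulo
bounded ones becomes a genuine cocycle in σ_{<k} Q for k small.

Neither the colimit nor the quotient complex is formed. The additive relation `singRel` between
cochains z and morphisms φ replaces them: `exists_singRel` and `exists_singRel_of_δ_mem` say that
every φ, and every cocycle z modulo bounded cochains, occurs; `exists_of_singRel_zero` and
`eq_zero_of_singRel_of_mem_boundedCochain` control the two kernels. The sequence is then that of
bounded cochains inside all cochains, with connecting map φ ↦ [δ z]. For n ≤ -2 the two Ext groups
around the connecting map are zero.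

Coherence supplies the resolutions: syzygies of finitely presented modules are again finitely
presented. -/

variable {R : Type u} [Ring R]

/-! ### Coherence and resolutions by iterated syzygies -/

/-- Over a left coherent ring, finitely generated submodules of `Rⁿ` are finitely presented. -/
lemma IsLeftCoherent.finitePresentation_submodule_pi (hR : IsLeftCoherent R) (n : ℕ)
    (S : Submodule R (Fin n → R)) (hS : S.FG) : Module.FinitePresentation R S := by
  induction n with
  | zero =>
    have : Module.Finite R S := Module.Finite.of_fg hS
    have : Subsingleton S := inferInstance
    exact Module.finitePresentation_of_projective _ _
  | succ n ih =>
    have : Module.Finite R S := Module.Finite.of_fg hS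
    -- The first coordinate presents S as an extension of a finitely generated, hence finitely
    -- presented, ideal by a submodule of Rⁿ. That kernel is finitely generated because the quotient
    -- is finitely presented, so induction applies to it.
    let I : Ideal R := S.map (LinearMap.proj 0)
    let l : S →ₗ[R] I := (LinearMap.proj 0 : (Fin (n + 1) → R) →ₗ[R] R).submoduleMap S
    have hl : Function.Surjective l := LinearMap.submoduleMap_surjective _ _
    have : Module.FinitePresentation R I := hR I (hS.map _)
    let t : (Fin (n + 1) → R) →ₗ[R] (Fin n → R) := LinearMap.funLeft R R Fin.succ
    let e : LinearMap.ker l →ₗ[R] (Fin n → R) := t ∘ₗ S.subtype ∘ₗ (LinearMap.ker l).subtype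
    have he : Function.Injective e := by
      rw [injective_iff_map_eq_zero]
      rintro ⟨⟨x, hx⟩, hx'⟩ h
      have h0 : x 0 = 0 := congr_arg Subtype.val (LinearMap.mem_ker.1 hx')
      ext i
      refine Fin.cases h0 (fun j => congr_fun h j) i
    have hfg : (LinearMap.ker l).FG := Module.FinitePresentation.fg_ker l hl
    have : Module.Finite R (LinearMap.ker l) := Module.Finite.of_fg hfg
    have := ih (LinearMap.range e) (by
      rw [LinearMap.range_eq_map]
      exact Module.Finite.fg_top.map e)
    have : Module.FinitePresentation R (LinearMap.ker l) :=
      Module.FinitePresentation.of_equiv (M := LinearMap.range e) (N := LinearMap.ker l)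
        (LinearEquiv.ofInjective e he).symm
    exact Module.finitePresentation_of_ker l hl

variable (R) in
/-- The finitely presented modules. -/
structure FPModule where
  /-- The underlying module. -/
  obj : ModuleCat.{u} R
  finitePresentation : Module.FinitePresentation R obj

namespace FPModule

variable (M : FPModule R)

lemma exists_cover : ∃ (n : ℕ) (f : (Fin n → R) →ₗ[R] M.obj), Function.Surjective f :=
  have := M.finitePresentation
  Module.Finite.exists_fin' R M.obj

/-- The rank of a free cover of a finitely presented module. -/
def coverRank : ℕ := M.exists_cover.choose

/-- A free cover of a finitely presented module. -/
abbrev cover : ModuleCat.{u} R := ModuleCat.of R (Fin M.coverRank → R)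

/-- The projection from the free cover of a finitely presented module. -/
def coverLinearMap : (Fin M.coverRank → R) →ₗ[R] M.obj := M.exists_cover.choose_spec.choose

lemma coverLinearMap_surjective : Function.Surjective M.coverLinearMap :=
  M.exists_cover.choose_spec.choose_spec

/-- The first syzygy of a finitely presented module over a coherent ring. -/
def syzygy (hR : IsLeftCoherent R) : FPModule R :=
  ⟨ModuleCat.of R (LinearMap.ker M.coverLinearMap),
    hR.finitePresentation_submodule_pi _ _
      (have := M.finitePresentation; Module.FinitePresentation.fg_ker _ M.coverLinearMap_surjective)⟩

variable (hR : IsLeftCoherent R)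

/-- The map from the cover of the syzygy to the cover. -/
def syzygyMap : (M.syzygy hR).cover ⟶ M.cover :=
  ModuleCat.ofHom ((LinearMap.ker M.coverLinearMap).subtype ∘ₗ (M.syzygy hR).coverLinearMap)

lemma range_syzygyMap :
    LinearMap.range (M.syzygyMap hR).hom = LinearMap.ker M.coverLinearMap := by
  have : LinearMap.range (M.syzygy hR).coverLinearMap = ⊤ :=
    LinearMap.range_eq_top.2 (M.syzygy hR).coverLinearMap_surjective
  exact (LinearMap.range_comp _ _).trans
    ((congr_arg (Submodule.map (LinearMap.ker M.coverLinearMap).subtype) this).trans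
      (Submodule.map_top _ |>.trans (Submodule.range_subtype _)))

lemma ker_syzygyMap :
    LinearMap.ker (M.syzygyMap hR).hom = LinearMap.ker (M.syzygy hR).coverLinearMap :=
  LinearMap.ker_comp_of_ker_eq_bot _ (Submodule.ker_subtype _)

lemma syzygyMap_comp_cover :
    M.syzygyMap hR ≫ ModuleCat.ofHom M.coverLinearMap = 0 := by
  ext1
  exact LinearMap.range_le_ker_iff.1 (M.range_syzygyMap hR).le

lemma syzygyMap_comp_syzygyMap :
    (M.syzygy hR).syzygyMap hR ≫ M.syzygyMap hR = 0 := by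
  ext1
  exact LinearMap.range_le_ker_iff.1
    ((range_syzygyMap _ hR).trans (ker_syzygyMap _ hR).symm).le

/-- The iterated syzygies. -/
def iteratedSyzygy : ℕ → FPModule R
  | 0 => M
  | n + 1 => (iteratedSyzygy n).syzygy hR

/-- The complex underlying the free resolution. -/
def resolutionComplex : ChainComplex (ModuleCat.{u} R) ℕ :=
  ChainComplex.of (fun n => (M.iteratedSyzygy hR n).cover)
    (fun n => (M.iteratedSyzygy hR n).syzygyMap hR)
    (fun n => (M.iteratedSyzygy hR n).syzygyMap_comp_syzygyMap hR)

lemma resolutionComplex_d (n : ℕ) :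
    (M.resolutionComplex hR).d (n + 1) n = (M.iteratedSyzygy hR n).syzygyMap hR :=
  ChainComplex.of_d (fun n => (M.iteratedSyzygy hR n).cover)
    (fun n => (M.iteratedSyzygy hR n).syzygyMap hR) n

instance (n : ℕ) : Projective ((M.resolutionComplex hR).X n) :=
  (IsProjective.iff_projective (R := R) (Fin (M.iteratedSyzygy hR n).coverRank → R)).1
    inferInstance

lemma resolutionComplex_exactAt_succ (n : ℕ) :
    (M.resolutionComplex hR).ExactAt (n + 1) := by
  rw [HomologicalComplex.exactAt_iff' _ (n + 1 + 1) (n + 1) n (by simp) (by simp),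
    ShortComplex.moduleCat_exact_iff_range_eq_ker]
  change LinearMap.range ((M.resolutionComplex hR).d (n + 1 + 1) (n + 1)).hom =
    LinearMap.ker ((M.resolutionComplex hR).d (n + 1) n).hom
  rw [resolutionComplex_d, resolutionComplex_d]
  exact (range_syzygyMap _ hR).trans (ker_syzygyMap _ hR).symm

/-- The augmentation of the free resolution. -/
def resolutionπ : M.resolutionComplex hR ⟶ (ChainComplex.single₀ _).obj M.obj :=
  (ChainComplex.toSingle₀Equiv _ _).symm ⟨ModuleCat.ofHom M.coverLinearMap, by
    rw [resolutionComplex_d]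
    exact M.syzygyMap_comp_cover hR⟩

lemma resolutionπ_f_zero : (M.resolutionπ hR).f 0 = ModuleCat.ofHom M.coverLinearMap :=
  ChainComplex.toSingle₀Equiv_symm_apply_f_zero _ _

instance : QuasiIso (M.resolutionπ hR) := ⟨fun n => by
  cases n
  -- In degree 0 the claim is exactness of the presentation of M by the two covers, together with
  -- surjectivity; in positive degrees both complexes are exact.
  · rw [ChainComplex.quasiIsoAt₀_iff, ShortComplex.quasiIso_iff_of_zeros']
    · have hex : (ShortComplex.mk (M.syzygyMap hR) (ModuleCat.ofHom M.coverLinearMap)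
          (M.syzygyMap_comp_cover hR)).Exact := by
        rw [ShortComplex.moduleCat_exact_iff_range_eq_ker]
        exact M.range_syzygyMap hR
      refine (ShortComplex.exact_and_epi_g_iff_of_iso ?_).2
        ⟨hex, (ModuleCat.epi_iff_surjective _).2 M.coverLinearMap_surjective⟩
      exact ShortComplex.isoMk (Iso.refl _) (Iso.refl _) (Iso.refl _)
        ((Category.id_comp _).trans ((M.resolutionComplex_d hR 0).symm.trans
          (Category.comp_id _).symm)) ((Category.id_comp _).trans
            ((M.resolutionπ_f_zero hR).symm.trans
              (Category.comp_id ((M.resolutionπ hR).f 0)).symm))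
    all_goals rfl
  · rw [quasiIsoAt_iff_exactAt']
    · apply resolutionComplex_exactAt_succ
    · apply ChainComplex.exactAt_succ_single_obj⟩

/-- The resolution of a finitely presented module over a left coherent ring by finitely generated
free modules. -/
def resolution : FGProjectiveResolution M.obj where
  complex := M.resolutionComplex hR
  π := M.resolutionπ hR
  finite n := inferInstanceAs (Module.Finite R (Fin (M.iteratedSyzygy hR n).coverRank → R))

end FPModule

open scoped TensorProduct
open CochainComplex.HomComplex

/-! ### Homology classes of cycles in complexes of abelian groups -/

section

variable (K : CochainComplex AddCommGrpCat.{u} ℤ) (n : ℤ)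

/-- The isomorphism between the quotient of cycles by boundaries and homology. -/
def homologyIsoQuotient :
    (K.sc' (n - 1) n (n + 1)).abLeftHomologyData.H ≅ K.homology n :=
  (K.sc' (n - 1) n (n + 1)).abHomologyIso.symm ≪≫
    (K.homologyIsoSc' (n - 1) n (n + 1) (by simp) (by simp)).symm

/-- The homology class of a cycle in a complex of abelian groups. -/
def cycleClass : (K.d n (n + 1)).hom.ker →+ K.homology n :=
  ((K.sc' (n - 1) n (n + 1)).abLeftHomologyData.π ≫ (homologyIsoQuotient K n).hom).hom

lemma cycleClass_surjective : Function.Surjective (cycleClass K n) :=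
  (AddCommGrpCat.epi_iff_surjective
    ((K.sc' (n - 1) n (n + 1)).abLeftHomologyData.π ≫ (homologyIsoQuotient K n).hom)).1
      inferInstance

lemma cycleClass_eq_zero_iff (x : (K.d n (n + 1)).hom.ker) :
    cycleClass K n x = 0 ↔ ∃ y, (K.d (n - 1) n).hom y = x.1 := by
  have h : Function.Injective (homologyIsoQuotient K n).hom.hom :=
    (AddCommGrpCat.mono_iff_injective (homologyIsoQuotient K n).hom).1 inferInstance
  refine (map_eq_zero_iff _ h).trans ((QuotientAddGroup.eq_zero_iff
    (N := (K.sc' (n - 1) n (n + 1)).abToCycles.range) x).trans ?_)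
  exact exists_congr fun y => Subtype.ext_iff

end

/-! ### Evaluation `Hom_R(A, R) ⊗_R B → Hom_R(A, B)` -/

section

variable (A B : ModuleCat.{u} R)

/-- The linear map `a ↦ φ a • b`. -/
def rankOne (φ : A →ₗ[R] R) (b : B) : A ⟶ B := ModuleCat.ofHom (φ.smulRight b)

/-- The canonical map `Hom_R(A, R) ⊗_R B → Hom_R(A, B)`. -/
def tensorToHom : BalancedTensor R (A →ₗ[R] R) B →+ (A ⟶ B) :=
  QuotientAddGroup.lift _
    (TensorProduct.liftAddHom
      (AddMonoidHom.mk' (fun φ => AddMonoidHom.mk' (fun b => rankOne A B φ b)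
        (fun b b' => ModuleCat.hom_ext (LinearMap.ext fun a => smul_add _ _ _)))
        (fun φ φ' => AddMonoidHom.ext fun b =>
          ModuleCat.hom_ext (LinearMap.ext fun a => add_smul (φ a) (φ' a) b)))
      (fun r φ b => ModuleCat.hom_ext (LinearMap.ext fun a => by
        change (r • φ a) • b = φ a • (r • b)
        rw [smul_comm, smul_assoc]))) (by
    rw [balancedRelations, AddSubgroup.closure_le]
    rintro _ ⟨φ, r, b, rfl⟩
    refine (map_sub _ _ _).trans (sub_eq_zero.2 ?_)
    exact ModuleCat.hom_ext (LinearMap.ext fun a => mul_smul (φ a) r b))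

/-- If `A` is finitely generated projective, then `Hom_R(A, R) ⊗_R B → Hom_R(A, B)` has
an inverse. -/
lemma exists_tensorToHom_inverse [Module.Finite R A] [Module.Projective R A] :
    ∃ g : (A ⟶ B) →+ BalancedTensor R (A →ₗ[R] R) B,
      (∀ f, tensorToHom A B (g f) = f) ∧ ∀ t, g (tensorToHom A B t) = t := by
  obtain ⟨n, f, hf⟩ := Module.Finite.exists_fin' R A
  obtain ⟨s, hs⟩ := Module.projective_lifting_property f LinearMap.id hf
  -- The `e i` and `φ i` form a dual basis of A, and the inverse is h ↦ ∑ φᵢ ⊗ h(eᵢ).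
  let e (i : Fin n) : A := f (Pi.single i 1)
  let φ (i : Fin n) : A →ₗ[R] R := LinearMap.proj i ∘ₗ s
  have basis (a : A) : ∑ i, φ i a • e i = a := by
    have h := LinearMap.pi_apply_eq_sum_univ f (s a)
    rw [← LinearMap.comp_apply, hs, LinearMap.id_apply] at h
    refine Eq.trans (Finset.sum_congr rfl fun i _ => ?_) h.symm
    change s a i • f (Pi.single i 1) = _
    congr 2
    ext j
    simp [Pi.single_apply, eq_comm]
  let g : (A ⟶ B) →+ BalancedTensor R (A →ₗ[R] R) B :=
    AddMonoidHom.mk' (fun h => ∑ i, BalancedTensor.tmul R (φ i) (h.hom (e i))) (fun h h' => by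
      rw [← Finset.sum_add_distrib]
      exact Finset.sum_congr rfl fun i _ =>
        congr_arg QuotientAddGroup.mk (TensorProduct.tmul_add _ _ _))
  refine ⟨g, fun h => ?_, fun t => ?_⟩
  · change tensorToHom A B (∑ i, BalancedTensor.tmul R (φ i) (h.hom (e i))) = h
    rw [map_sum]
    refine ModuleCat.hom_ext (LinearMap.ext fun a => ?_)
    rw [ModuleCat.hom_sum, LinearMap.sum_apply]
    conv_rhs => rw [← basis a, map_sum]
    exact Finset.sum_congr rfl fun i _ => (map_smul h.hom (φ i a) (e i)).symm
  · suffices g.comp (tensorToHom A B) = AddMonoidHom.id _ from DFunLike.congr_fun this t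
    refine BalancedTensor.hom_ext R fun ψ b => ?_
    change ∑ i, BalancedTensor.tmul R (φ i) (ψ (e i) • b) = _
    have (i : Fin n) : BalancedTensor.tmul R (φ i) (ψ (e i) • b) =
        BalancedTensor.tmul R (MulOpposite.op (ψ (e i)) • φ i) b :=
      ((QuotientAddGroup.eq_iff_sub_mem (N := balancedRelations R (A →ₗ[R] R) B)).2
        (AddSubgroup.subset_closure ⟨φ i, ψ (e i), b, rfl⟩)).symm
    simp only [this]
    have hψ : ∑ i, MulOpposite.op (ψ (e i)) • φ i = ψ := by
      ext a
      rw [LinearMap.sum_apply]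
      conv_rhs => rw [← basis a, map_sum]
      exact Finset.sum_congr rfl fun i _ => (map_smul ψ (φ i a) (e i)).symm
    conv_rhs => rw [← hψ]
    change _ = QuotientAddGroup.mk' _ ((∑ i, MulOpposite.op (ψ (e i)) • φ i) ⊗ₜ[ℤ] b)
    rw [TensorProduct.sum_tmul, map_sum]
    rfl

end

/-! ### The tensor complex `P^* ⊗_R Q` as a complex of cochains with bounded below support -/

section

variable (P Q : CochainComplex (ModuleCat.{u} R) ℤ)

/-- A morphism `P^p → Q^q` as a cochain of degree `n`. -/
def singleHom (p q n : ℤ) : (P.X p ⟶ Q.X q) →+ Cochain P Q n :=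
  AddMonoidHom.mk' (fun f => Cochain.single f n) (fun f g => by
    ext p' q' h
    rw [Cochain.add_v]
    by_cases hp : p' = p
    · by_cases hq : q' = q
      · subst hp hq
        simp
      · simp [Cochain.single_v_eq_zero' _ _ _ _ _ hq]
    · simp [Cochain.single_v_eq_zero _ _ _ _ _ hp])

/-- The inclusion of a summand in the tensor product complex. -/
def tensorι {X : CochainComplex (ModuleCat.{u} Rᵐᵒᵖ) ℤ} {Y : CochainComplex (ModuleCat.{u} R) ℤ}
    (a b n : ℤ) (h : a + b = n) : BalancedTensor R (X.X a) (Y.X b) →+ (tensorComplex X Y).X n :=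
  (HomologicalComplex.ιMapBifunctor X Y (tensorBifunctor R) (.up ℤ) a b n h).hom

lemma tensorComplex_hom_ext {X : CochainComplex (ModuleCat.{u} Rᵐᵒᵖ) ℤ}
    {Y : CochainComplex (ModuleCat.{u} R) ℤ} {n : ℤ} {G : Type u} [AddCommGroup G]
    {f g : (tensorComplex X Y).X n →+ G}
    (h : ∀ (a b : ℤ) (hab : a + b = n) t, f (tensorι a b n hab t) = g (tensorι a b n hab t)) :
    f = g := by
  have : AddCommGrpCat.ofHom f = AddCommGrpCat.ofHom g :=
    HomologicalComplex.mapBifunctor.hom_ext (fun a b hab =>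
      AddCommGrpCat.hom_ext (AddMonoidHom.ext (h a b hab)))
  exact congr_arg AddCommGrpCat.Hom.hom this

lemma tensorComplex_d_tensorι {X : CochainComplex (ModuleCat.{u} Rᵐᵒᵖ) ℤ}
    {Y : CochainComplex (ModuleCat.{u} R) ℤ} (a b n : ℤ) (h : a + b = n)
    (t : BalancedTensor R (X.X a) (Y.X b)) :
    ((tensorComplex X Y).d n (n + 1)).hom (tensorι a b n h t) =
      tensorι (a + 1) b (n + 1) (by lia)
        (BalancedTensor.map R (X.d a (a + 1)).hom LinearMap.id t) +
      a.negOnePow • tensorι a (b + 1) (n + 1) (by lia)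
        (BalancedTensor.map R LinearMap.id (Y.d b (b + 1)).hom t) := by
  have h₁ := HomologicalComplex.mapBifunctor.d₁_eq X Y (tensorBifunctor R) (.up ℤ)
    (show (ComplexShape.up ℤ).Rel a (a + 1) from rfl) b (n + 1) (by change a + 1 + b = _; lia)
  have h₂ := HomologicalComplex.mapBifunctor.d₂_eq X Y (tensorBifunctor R) (.up ℤ) a
    (show (ComplexShape.up ℤ).Rel b (b + 1) from rfl) (n + 1) (by change a + (b + 1) = _; lia)
  have h₃ : HomologicalComplex.ιMapBifunctor X Y (tensorBifunctor R) (.up ℤ) a b n h ≫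
      (HomologicalComplex.mapBifunctor X Y (tensorBifunctor R) (.up ℤ)).d n (n + 1) =
      HomologicalComplex.mapBifunctor.d₁ X Y (tensorBifunctor R) (.up ℤ) a b (n + 1) +
      HomologicalComplex.mapBifunctor.d₂ X Y (tensorBifunctor R) (.up ℤ) a b (n + 1) := by
    rw [HomologicalComplex.mapBifunctor.d_eq, Preadditive.comp_add,
      HomologicalComplex.mapBifunctor.ι_D₁, HomologicalComplex.mapBifunctor.ι_D₂]
  rw [h₁, h₂] at h₃
  refine (ConcreteCategory.congr_hom h₃ t).trans ?_
  refine congr_arg (fun y : (tensorComplex X Y).X (n + 1) => y + a.negOnePow •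
    tensorι a (b + 1) (n + 1) (by lia) (BalancedTensor.map R LinearMap.id (Y.d b (b + 1)).hom t)) ?_
  rw [show ComplexShape.ε₁ (.up ℤ) (.up ℤ) (.up ℤ) (a, b) = 1 from rfl, one_smul]
  rfl

/-- The cochain attached to an element of `P^* ⊗_R Q`: the element `φ ⊗ y` with `φ` of degree `a`
and `y` of degree `b` corresponds to `x ↦ (-1)^{ab} φ x • y`. -/
def tensorToCochain (n : ℤ) : (tensorComplex (dualComplex P) Q).X n →+ Cochain P Q n :=
  (HomologicalComplex.mapBifunctorDesc (A := AddCommGrpCat.of (Cochain P Q n))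
    (fun a b _ => (a * b).negOnePow • AddCommGrpCat.ofHom
      ((singleHom P Q (-a) b n).comp (tensorToHom (P.X (-a)) (Q.X b))))).hom

lemma tensorToCochain_tensorι (a b n : ℤ) (h : a + b = n)
    (t : BalancedTensor R (P.X (-a) →ₗ[R] R) (Q.X b)) :
    tensorToCochain P Q n (tensorι (X := dualComplex P) a b n h t) =
      (a * b).negOnePow • Cochain.single (tensorToHom (P.X (-a)) (Q.X b) t) n :=
  ConcreteCategory.congr_hom (HomologicalComplex.ι_mapBifunctorDesc
    (A := AddCommGrpCat.of (Cochain P Q n)) (F := tensorBifunctor R) (K₁ := dualComplex P)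
    (c := .up ℤ)
    (fun a b _ => (a * b).negOnePow • AddCommGrpCat.ofHom
      ((singleHom P Q (-a) b n).comp (tensorToHom (P.X (-a)) (Q.X b)))) a b h) t

lemma tensorToHom_map_right (A : ModuleCat.{u} R) {B B' : ModuleCat.{u} R} (g : B ⟶ B')
    (t : BalancedTensor R (A →ₗ[R] R) B) :
    tensorToHom A B' (BalancedTensor.map R LinearMap.id g.hom t) = tensorToHom A B t ≫ g := by
  suffices (tensorToHom A B').comp (BalancedTensor.map R LinearMap.id g.hom) =
      (Preadditive.rightComp A g).comp (tensorToHom A B) from DFunLike.congr_fun this t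
  exact BalancedTensor.hom_ext R fun φ b =>
    ModuleCat.hom_ext (LinearMap.ext fun a => (map_smul g.hom (φ a) b).symm)

lemma tensorToHom_map_left (A A' B : ModuleCat.{u} R) (g : A' ⟶ A) (ε : ℤˣ)
    (t : BalancedTensor R (A →ₗ[R] R) B) :
    tensorToHom A' B (BalancedTensor.map R (ε • dualMap g).hom LinearMap.id t) =
      ε • (g ≫ tensorToHom A B t) := by
  suffices (tensorToHom A' B).comp (BalancedTensor.map R (ε • dualMap g).hom LinearMap.id) =
      ε • (Preadditive.leftComp B g).comp (tensorToHom A B) from DFunLike.congr_fun this t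
  refine BalancedTensor.hom_ext R fun φ b => ModuleCat.hom_ext (LinearMap.ext fun a => ?_)
  change (ε • φ (g.hom a)) • b = ε • (φ (g.hom a) • b)
  rw [smul_assoc]

/-- The sign (-1)^(ab) is what makes this a map of complexes: with the sign (-1)^(a+1) of the dual
differential, the term φ ∘ d gets (-1)^((a+1)b + a+1) = (-1)^(ab) (-1)^(a+b+1), as in the
differential of Hom(P, Q), and the term d ∘ φ gets (-1)^(a + a(b+1)) = (-1)^(ab). -/
lemma tensorToCochain_d (n : ℤ) (x : (tensorComplex (dualComplex P) Q).X n) :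
    tensorToCochain P Q (n + 1) (((tensorComplex (dualComplex P) Q).d n (n + 1)).hom x) =
      δ n (n + 1) (tensorToCochain P Q n x) := by
  suffices (tensorToCochain P Q (n + 1)).comp
      ((tensorComplex (dualComplex P) Q).d n (n + 1)).hom =
      (δ_hom ℤ P Q n (n + 1)).toAddMonoidHom.comp (tensorToCochain P Q n) from
    DFunLike.congr_fun this x
  refine tensorComplex_hom_ext fun a b hab t => ?_
  change tensorToCochain P Q (n + 1) _ = δ n (n + 1) (tensorToCochain P Q n _)
  let f : P.X (-a) ⟶ Q.X b := tensorToHom _ _ t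
  have h₁ : tensorToCochain P Q (n + 1) (tensorι (X := dualComplex P) (a + 1) b (n + 1) (by lia)
      (BalancedTensor.map R ((dualComplex P).d a (a + 1)).hom LinearMap.id t)) =
      ((a + 1) * b).negOnePow • (a + 1).negOnePow •
        singleHom P Q _ _ (n + 1) (P.d (-(a + 1)) (-a) ≫ f) := by
    refine (tensorToCochain_tensorι ..).trans (congr_arg _ ?_)
    refine (congr_arg (singleHom P Q _ _ (n + 1)) (tensorToHom_map_left ..)).trans ?_
    exact map_zsmul (singleHom P Q _ _ (n + 1)) _ _
  have h₂ : tensorToCochain P Q (n + 1) (a.negOnePow • tensorι (X := dualComplex P) a (b + 1)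
      (n + 1) (by lia) (BalancedTensor.map R LinearMap.id (Q.d b (b + 1)).hom t)) =
      a.negOnePow • (a * (b + 1)).negOnePow •
        singleHom P Q _ _ (n + 1) (f ≫ Q.d b (b + 1)) := by
    refine (map_zsmul (tensorToCochain P Q (n + 1)) _ _).trans
      (congr_arg ((a.negOnePow : ℤ) • ·) ?_)
    refine (tensorToCochain_tensorι ..).trans (congr_arg _ ?_)
    exact congr_arg (singleHom P Q _ _ (n + 1)) (tensorToHom_map_right ..)
  refine (congr_arg (tensorToCochain P Q (n + 1)) (tensorComplex_d_tensorι ..)).trans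
    ((map_add _ _ _).trans ((congr_arg₂ (· + ·) h₁ h₂).trans
      (Eq.trans ?_ (congr_arg (δ n (n + 1)) (tensorToCochain_tensorι P Q a b n hab t)).symm)))
  rw [δ_units_smul, Cochain.δ_single _ n (n + 1) rfl (-(a + 1)) (b + 1) (by lia) rfl, smul_add,
    smul_smul, smul_smul, smul_smul, ← Int.negOnePow_add, ← Int.negOnePow_add,
    ← Int.negOnePow_add, show a + a * (b + 1) = a * b + 2 * a by ring, Int.negOnePow_add (a * b),
    Int.negOnePow_two_mul, mul_one, ← hab, show (a + 1) * b + (a + 1) = a * b + (a + b + 1) by ring]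
  exact add_comm _ _

lemma units_smul_smul_self {G : Type*} [AddCommGroup G] (ε : ℤˣ) (x : G) : ε • ε • x = x := by
  rw [smul_smul, Int.units_mul_self, one_smul]

/-! ### The image of the comparison map: bounded cochains -/

/-- The cochains which vanish in all sufficiently small degrees. -/
def boundedCochain (n : ℤ) : AddSubgroup (Cochain P Q n) where
  carrier := {z | ∃ k : ℤ, ∀ (p q : ℤ) (h : p + n = q), q < k → z.v p q h = 0}
  zero_mem' := ⟨0, fun _ _ _ _ => rfl⟩
  add_mem' := by
    rintro z z' ⟨k, hk⟩ ⟨k', hk'⟩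
    refine ⟨min k k', fun p q h hq => ?_⟩
    rw [Cochain.add_v, hk p q h (by lia), hk' p q h (by lia), add_zero]
  neg_mem' := by
    rintro z ⟨k, hk⟩
    exact ⟨k, fun p q h hq => by rw [Cochain.neg_v, hk p q h hq, neg_zero]⟩

variable {P Q}

lemma tensorToCochain_mem_boundedCochain (n : ℤ) (x : (tensorComplex (dualComplex P) Q).X n) :
    tensorToCochain P Q n x ∈ boundedCochain P Q n := by
  -- Membership for all x means that the composite into the quotient group vanishes, which can be
  -- tested on the summands; there the cochain is concentrated in the single target degree b.
  rw [← QuotientAddGroup.eq_zero_iff]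
  suffices (QuotientAddGroup.mk' (boundedCochain P Q n)).comp (tensorToCochain P Q n) = 0 from
    DFunLike.congr_fun this x
  refine tensorComplex_hom_ext fun a b hab t => ?_
  refine (QuotientAddGroup.eq_zero_iff _).2 ?_
  refine ⟨b, fun p q h hq => ?_⟩
  refine (Cochain.congr_v (tensorToCochain_tensorι P Q a b n hab t) p q h).trans ?_
  rw [Cochain.units_smul_v, Cochain.single_v_eq_zero' _ _ _ _ _ (by lia), smul_zero]

/-- The components of a cochain, as additive maps. -/
def cochainV {n : ℤ} (p q : ℤ) (h : p + n = q) : Cochain P Q n →+ (P.X p ⟶ Q.X q) :=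
  AddMonoidHom.mk' (fun z => z.v p q h) (fun _ _ => Cochain.add_v _ _ _ _ _)

lemma cochain_sum_v {ι : Type*} {n : ℤ} (S : Finset ι) (f : ι → Cochain P Q n) (p q : ℤ)
    (h : p + n = q) : (∑ i ∈ S, f i).v p q h = ∑ i ∈ S, (f i).v p q h :=
  map_sum (cochainV p q h) f S

/-- An inverse of `tensorToHom` on the terms of a complex. -/
def homToTensor (hP : IsFGProj P) (p q : ℤ) :
    (P.X p ⟶ Q.X q) →+ BalancedTensor R (P.X p →ₗ[R] R) (Q.X q) :=
  have := (hP p).1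
  have := (hP p).2
  (exists_tensorToHom_inverse (P.X p) (Q.X q)).choose

lemma tensorToHom_homToTensor (hP : IsFGProj P) (p q : ℤ) (f : P.X p ⟶ Q.X q) :
    tensorToHom _ _ (homToTensor hP p q f) = f :=
  have := (hP p).1
  have := (hP p).2
  (exists_tensorToHom_inverse (P.X p) (Q.X q)).choose_spec.1 f

lemma homToTensor_tensorToHom (hP : IsFGProj P) (p q : ℤ)
    (t : BalancedTensor R (P.X p →ₗ[R] R) (Q.X q)) :
    homToTensor hP p q (tensorToHom _ _ t) = t :=
  have := (hP p).1
  have := (hP p).2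
  (exists_tensorToHom_inverse (P.X p) (Q.X q)).choose_spec.2 t

/-- The summand of index `a` of the element of `P^* ⊗_R Q` corresponding to a cochain. -/
def cochainSummand (hP : IsFGProj P) (n a : ℤ) :
    Cochain P Q n →+ (tensorComplex (dualComplex P) Q).X n :=
  (a * (n - a)).negOnePow • (tensorι (X := dualComplex P) a (n - a) n (by lia)).comp
    ((homToTensor hP (-a) (n - a)).comp (cochainV (-a) (n - a) (by lia)))

lemma cochainSummand_tensorι_self (hP : IsFGProj P) (n a b : ℤ) (h : a + b = n)
    (t : BalancedTensor R (P.X (-a) →ₗ[R] R) (Q.X b)) :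
    cochainSummand hP n a (tensorToCochain P Q n (tensorι (X := dualComplex P) a b n h t)) =
      tensorι (X := dualComplex P) a b n h t := by
  obtain rfl : b = n - a := by lia
  refine (congr_arg (cochainSummand hP n a) (tensorToCochain_tensorι ..)).trans ?_
  refine (map_zsmul (cochainSummand hP n a) _ _).trans ?_
  have : cochainSummand hP n a (Cochain.single (tensorToHom (P.X (-a)) (Q.X (n - a)) t) n) =
      (a * (n - a)).negOnePow • tensorι (X := dualComplex P) a (n - a) n h t := by
    refine congr_arg (fun y => (a * (n - a)).negOnePow •
      tensorι (X := dualComplex P) a (n - a) n h y) ?_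
    change homToTensor hP (-a) (n - a) ((Cochain.single _ n).v (-a) (n - a) (by lia)) = t
    rw [Cochain.single_v, homToTensor_tensorToHom]
  rw [this]
  exact units_smul_smul_self _ _

lemma cochainSummand_tensorι_of_ne (hP : IsFGProj P) (n a b a' : ℤ) (h : a + b = n)
    (t : BalancedTensor R (P.X (-a) →ₗ[R] R) (Q.X b)) (ha : a' ≠ a) :
    cochainSummand hP n a' (tensorToCochain P Q n (tensorι (X := dualComplex P) a b n h t)) =
      0 := by
  refine (congr_arg (cochainSummand hP n a') (tensorToCochain_tensorι ..)).trans ?_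
  refine (map_zsmul (cochainSummand hP n a') _ _).trans ?_
  have h' : -a' + n = n - a' := by lia
  have : (Cochain.single (tensorToHom (P.X (-a)) (Q.X b) t) n : Cochain P Q n).v _ _ h' = 0 :=
    Cochain.single_v_eq_zero _ _ _ _ _ (by lia)
  have : cochainSummand hP n a' (Cochain.single (tensorToHom (P.X (-a)) (Q.X b) t) n) = 0 := by
    let G := (a' * (n - a')).negOnePow • (tensorι (X := dualComplex P) (Y := Q) a' (n - a') n
      (by lia)).comp (homToTensor hP (-a') (n - a'))
    exact (congr_arg G this).trans (map_zero G)
  rw [this, smul_zero]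

/-- An element of the direct sum is the sum of its finitely many components. Asking for all finite
sets containing S makes the property stable under addition, so that it can be checked on generators.
-/
lemma exists_sum_cochainSummand (hP : IsFGProj P) (n : ℤ)
    (x : (tensorComplex (dualComplex P) Q).X n) :
    ∃ S : Finset ℤ, ∀ S', S ⊆ S' →
      ∑ a ∈ S', cochainSummand hP n a (tensorToCochain P Q n x) = x := by
  let H : AddSubgroup ((tensorComplex (dualComplex P) Q).X n) :=
    { carrier := {x | ∃ S : Finset ℤ, ∀ S', S ⊆ S' →
        ∑ a ∈ S', cochainSummand hP n a (tensorToCochain P Q n x) = x}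
      zero_mem' := ⟨∅, fun S' _ => by simp⟩
      add_mem' := by
        rintro x y ⟨S, hS⟩ ⟨T, hT⟩
        refine ⟨S ∪ T, fun S' h => ?_⟩
        simp only [map_add, Finset.sum_add_distrib]
        rw [hS S' (Finset.union_subset_left h), hT S' (Finset.union_subset_right h)]
      neg_mem' := by
        rintro x ⟨S, hS⟩
        refine ⟨S, fun S' h => ?_⟩
        simp only [map_neg, Finset.sum_neg_distrib]
        rw [hS S' h] }
  change x ∈ H
  rw [← QuotientAddGroup.eq_zero_iff]
  suffices QuotientAddGroup.mk' H = 0 from DFunLike.congr_fun this x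
  refine tensorComplex_hom_ext fun a b hab t => (QuotientAddGroup.eq_zero_iff _).2 ?_
  refine ⟨{a}, fun S' h => ?_⟩
  rw [Finset.sum_eq_single_of_mem a (h (Finset.mem_singleton_self a))
    (fun a' _ ha' => cochainSummand_tensorι_of_ne hP n a b a' hab t ha')]
  exact cochainSummand_tensorι_self hP n a b hab t

lemma tensorToCochain_injective (hP : IsFGProj P) (n : ℤ) :
    Function.Injective (tensorToCochain P Q n) := by
  rw [injective_iff_map_eq_zero]
  intro x hx
  obtain ⟨S, hS⟩ := exists_sum_cochainSummand hP n x
  rw [← hS S subset_rfl, hx]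
  simp

lemma tensorToCochain_cochainSummand (hP : IsFGProj P) (n a : ℤ) (z : Cochain P Q n) :
    tensorToCochain P Q n (cochainSummand hP n a z) =
      Cochain.single (z.v (-a) (n - a) (by lia)) n := by
  refine (map_zsmul (tensorToCochain P Q n) _ _).trans ?_
  refine (congr_arg (((a * (n - a)).negOnePow : ℤ) • ·) (tensorToCochain_tensorι ..)).trans ?_
  refine (units_smul_smul_self _ _).trans ?_
  exact congr_arg (Cochain.single · n) (tensorToHom_homToTensor ..)

lemma exists_tensorToCochain_eq (hP : IsFGProj P) (N : ℤ) [P.IsStrictlyLE N] {n : ℤ}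
    {z : Cochain P Q n} (hz : z ∈ boundedCochain P Q n) : ∃ x, tensorToCochain P Q n x = z := by
  obtain ⟨k, hk⟩ := hz
  -- Only source degrees p = -a ≤ N and target degrees q = n - a ≥ k contribute, so the range of a
  -- is finite.
  refine ⟨∑ a ∈ Finset.Icc (-N) (n - k), cochainSummand hP n a z, ?_⟩
  rw [map_sum, Finset.sum_congr rfl (fun a _ => tensorToCochain_cochainSummand hP n a z)]
  ext p q h : 1
  rw [cochain_sum_v]
  by_cases hp : N < p
  · exact (P.isZero_of_isStrictlyLE N p hp).eq_of_src _ _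
  by_cases hq : q < k
  · rw [hk p q h hq]
    refine Finset.sum_eq_zero fun a ha => Cochain.single_v_eq_zero' _ _ _ _ _ ?_
    rw [Finset.mem_Icc] at ha
    lia
  · rw [Finset.sum_eq_single_of_mem (-p) (Finset.mem_Icc.2 (by lia))
      (fun a _ ha => Cochain.single_v_eq_zero _ _ _ _ _ (by lia))]
    obtain ⟨a, rfl⟩ : ∃ a, p = -a := ⟨-p, by lia⟩
    obtain rfl : q = n - a := by lia
    have (a' : ℤ) (ha' : a' = a) : (Cochain.single (z.v (-a') (n - a') (by lia)) n).v (-a) (n - a) h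
        = z.v (-a) (n - a) h := by
      subst ha'
      exact Cochain.single_v _ _ _
    exact this _ (by lia)

variable (P Q) in
/-- The cocycles which vanish in all sufficiently small degrees. -/
def boundedCocycle (n : ℤ) : AddSubgroup (Cocycle P Q n) :=
  (boundedCochain P Q n).comap (Cocycle.toCochainAddMonoidHom P Q n)

/-- The homology of `P^* ⊗_R Q` is computed by the cochains which vanish in all sufficiently small
degrees. -/
lemma exists_boundedCocycle_toHomology (hP : IsFGProj P) (N : ℤ) [P.IsStrictlyLE N] (n : ℤ) :
    ∃ c : boundedCocycle P Q n →+ (tensorComplex (dualComplex P) Q).homology n,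
      Function.Surjective c ∧
      ∀ w, c w = 0 ↔ ∃ y ∈ boundedCochain P Q (n - 1), δ (n - 1) n y = w.1.1 := by
  let K := tensorComplex (dualComplex P) Q
  let τ (m : ℤ) := tensorToCochain P Q m
  have hτd (m m' : ℤ) (h : m + 1 = m') (x : K.X m) :
      τ m' ((K.d m m').hom x) = δ m m' (τ m x) := by
    subst h
    exact tensorToCochain_d P Q m x
  have hτ (m : ℤ) : Function.Injective (τ m) := tensorToCochain_injective hP m
  let f : (K.d n (n + 1)).hom.ker →+ boundedCocycle P Q n :=
    AddMonoidHom.mk' (fun x => ⟨Cocycle.mk (τ n x.1) (n + 1) rfl (by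
        rw [← hτd n (n + 1) rfl, AddMonoidHom.mem_ker.1 x.2, map_zero]),
      tensorToCochain_mem_boundedCochain n x.1⟩)
      (fun x y => Subtype.ext (Cocycle.ext (map_add (τ n) x.1 y.1)))
  have hf : Function.Bijective f := by
    refine ⟨fun x y h => Subtype.ext (hτ n ?_), fun w => ?_⟩
    · exact congr_arg (fun w : boundedCocycle P Q n => w.1.1) h
    · obtain ⟨x, hx⟩ := exists_tensorToCochain_eq hP N w.2
      refine ⟨⟨x, hτ (n + 1) ?_⟩, Subtype.ext (Cocycle.ext hx)⟩
      refine (hτd n (n + 1) rfl x).trans (Eq.trans ?_ (map_zero _).symm)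
      exact (congr_arg (δ n (n + 1)) hx).trans (Cocycle.δ_eq_zero w.1 (n + 1))
  let e := AddEquiv.ofBijective f hf
  refine ⟨(cycleClass K n).comp e.symm.toAddMonoidHom,
    (cycleClass_surjective K n).comp e.symm.surjective, fun w => ?_⟩
  obtain ⟨x, rfl⟩ := e.surjective w
  change cycleClass K n (e.symm (e x)) = 0 ↔ _
  rw [e.symm_apply_apply, cycleClass_eq_zero_iff]
  constructor
  · rintro ⟨y, hy⟩
    refine ⟨τ (n - 1) y, tensorToCochain_mem_boundedCochain _ _, ?_⟩
    rw [← hτd (n - 1) n (by lia), hy]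
    rfl
  · rintro ⟨y, hy, h⟩
    obtain ⟨y, rfl⟩ := exists_tensorToCochain_eq hP N hy
    exact ⟨y, hτ n ((hτd (n - 1) n (by lia) y).trans h)⟩

end

/-! ### Stupid truncations -/

section

/-- The module `A` if `c` holds, and `0` otherwise. -/
def truncX (c : Prop) [h : Decidable c] (A : ModuleCat.{u} R) : ModuleCat.{u} R :=
  match h with
  | isTrue _ => A
  | isFalse _ => ModuleCat.of R PUnit

/-- The inclusion `truncX c A ⟶ A`. -/
def truncι (c : Prop) [h : Decidable c] (A : ModuleCat.{u} R) : truncX c A ⟶ A :=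
  match h with
  | isTrue _ => 𝟙 A
  | isFalse _ => 0

/-- The projection `A ⟶ truncX c A`. -/
def truncπ (c : Prop) [h : Decidable c] (A : ModuleCat.{u} R) : A ⟶ truncX c A :=
  match h with
  | isTrue _ => 𝟙 A
  | isFalse _ => 0

variable (c : Prop) [h : Decidable c] (A : ModuleCat.{u} R)

lemma isZero_truncX (hc : ¬ c) : IsZero (truncX c A) := by
  cases h with
  | isTrue h => exact absurd h hc
  | isFalse h => exact ModuleCat.isZero_of_subsingleton (ModuleCat.of R PUnit)

lemma truncι_truncπ : truncι c A ≫ truncπ c A = 𝟙 _ := by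
  cases h with
  | isTrue h => exact Category.id_comp (𝟙 A)
  | isFalse h => exact (ModuleCat.isZero_of_subsingleton (ModuleCat.of R PUnit)).eq_of_src _ _

lemma truncπ_truncι (hc : c) : truncπ c A ≫ truncι c A = 𝟙 _ := by
  cases h with
  | isTrue h => exact Category.id_comp (𝟙 A)
  | isFalse h => exact absurd hc h

lemma truncπ_truncι_assoc (hc : c) {B : ModuleCat.{u} R} (f : A ⟶ B) :
    truncπ c A ≫ truncι c A ≫ f = f := by
  rw [← Category.assoc, truncπ_truncι c A hc, Category.id_comp]

lemma truncπ_truncι_of_not (hc : ¬ c) : truncπ c A ≫ truncι c A = 0 := by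
  rw [(isZero_truncX c A hc).eq_of_tgt (truncπ c A) 0, zero_comp]

lemma finite_projective_truncX (hA : Module.Finite R A ∧ Module.Projective R A) :
    Module.Finite R (truncX c A) ∧ Module.Projective R (truncX c A) := by
  cases h with
  | isTrue h => exact hA
  | isFalse h =>
    exact ⟨inferInstanceAs (Module.Finite R PUnit.{u + 1}), inferInstanceAs (Module.Projective R PUnit.{u + 1})⟩

end

section

variable (c : ℤ → Prop) [DecidablePred c] (K : CochainComplex (ModuleCat.{u} R) ℤ)

/-- The complex with terms `K^i` if `c i` holds, and `0` otherwise. -/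
def truncComplex : CochainComplex (ModuleCat.{u} R) ℤ where
  X i := truncX (c i) (K.X i)
  d i j := truncι _ _ ≫ K.d i j ≫ truncπ _ _
  shape i j h := by rw [K.shape i j h, zero_comp, comp_zero]
  d_comp_d' i j k _ _ := by
    by_cases hc : c j
    · simp only [Category.assoc]
      rw [truncπ_truncι_assoc _ _ hc, K.d_comp_d_assoc, zero_comp, comp_zero]
    · rw [(isZero_truncX _ (K.X j) hc).eq_of_tgt (truncι _ _ ≫ K.d i j ≫ truncπ _ _) 0, zero_comp]

variable {c}

/-- The projection to a truncation that is closed under going down. -/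
def toTruncComplex (hc : ∀ i, c (i + 1) → c i) : K ⟶ truncComplex c K where
  f i := truncπ _ _
  comm' i j hij := by
    obtain rfl : i + 1 = j := hij
    change truncπ _ _ ≫ truncι _ _ ≫ K.d i (i + 1) ≫ truncπ _ _ = _
    by_cases h : c (i + 1)
    · rw [truncπ_truncι_assoc _ _ (hc i h)]
      rfl
    · exact (isZero_truncX _ _ h).eq_of_tgt _ _

/-- The inclusion of a truncation that is closed under going up. -/
def fromTruncComplex (hc : ∀ i, c i → c (i + 1)) : truncComplex c K ⟶ K where
  f i := truncι _ _
  comm' i j hij := by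
    obtain rfl : i + 1 = j := hij
    change _ = (truncι _ _ ≫ K.d i (i + 1) ≫ truncπ _ _) ≫ truncι _ _
    by_cases h : c i
    · rw [Category.assoc, Category.assoc, truncπ_truncι _ _ (hc i h), Category.comp_id]
      rfl
    · exact (isZero_truncX _ _ h).eq_of_src _ _

/-- The morphism between truncations given by an implication of the conditions. -/
def truncComplexMap {c' : ℤ → Prop} [DecidablePred c'] (h : ∀ i, c' i → c i)
    (hc' : ∀ i, c' (i + 1) → c' i) : truncComplex c K ⟶ truncComplex c' K where
  f i := truncι _ _ ≫ truncπ _ _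
  comm' i j hij := by
    obtain rfl : i + 1 = j := hij
    change (truncι _ _ ≫ truncπ _ _) ≫ truncι _ _ ≫ K.d i (i + 1) ≫ truncπ _ _ =
      (truncι _ _ ≫ K.d i (i + 1) ≫ truncπ _ _) ≫ truncι _ _ ≫ truncπ _ _
    by_cases hi : c' (i + 1)
    · simp only [Category.assoc]
      rw [truncπ_truncι_assoc _ _ (hc' i hi), truncπ_truncι_assoc _ _ (h _ hi)]
    · exact (isZero_truncX _ _ hi).eq_of_tgt _ _

lemma toTruncComplex_truncComplexMap {c' : ℤ → Prop} [DecidablePred c'] (h : ∀ i, c' i → c i)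
    (hc : ∀ i, c (i + 1) → c i) (hc' : ∀ i, c' (i + 1) → c' i) :
    toTruncComplex K hc ≫ truncComplexMap K h hc' = toTruncComplex K hc' := by
  ext1 i
  change truncπ _ _ ≫ truncι _ _ ≫ truncπ _ _ = truncπ _ _
  by_cases hi : c' i
  · rw [truncπ_truncι_assoc _ _ (h _ hi)]
  · exact (isZero_truncX _ _ hi).eq_of_tgt _ _

end

section

variable (K : CochainComplex (ModuleCat.{u} R) ℤ) (k : ℤ)

/-- The stupid truncation in degrees `< k`. -/
abbrev truncLT : CochainComplex (ModuleCat.{u} R) ℤ := truncComplex (· < k) K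

/-- The stupid truncation in degrees `≥ k`. -/
abbrev truncGE : CochainComplex (ModuleCat.{u} R) ℤ := truncComplex (k ≤ ·) K

/-- The projection to the stupid truncation in degrees `< k`. -/
def toTruncLT : K ⟶ truncLT K k := toTruncComplex K (fun i (h : i + 1 < k) => by lia)

/-- The degreewise section of the projection to the stupid truncation in degrees `< k`. -/
def truncLTSection : Cochain (truncLT K k) K 0 := Cochain.ofHoms (fun _ => truncι _ _)

/-- The transition map between stupid truncations. -/
def truncLTMap {k k' : ℤ} (h : k' ≤ k) : truncLT K k ⟶ truncLT K k' :=
  truncComplexMap K (fun i (_ : i < k') => by lia) (fun i (h : i + 1 < k') => by lia)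

lemma toTruncLT_truncLTMap {k k' : ℤ} (h : k' ≤ k) :
    toTruncLT K k ≫ truncLTMap K h = toTruncLT K k' :=
  toTruncComplex_truncComplexMap ..

lemma isZero_truncLT_X (i : ℤ) (hi : k ≤ i) : IsZero ((truncLT K k).X i) :=
  isZero_truncX _ _ (by lia)

lemma isIso_toTruncLT_f (i : ℤ) (hi : i < k) :
    (toTruncLT K k).f i ≫ (truncLTSection K k).v i i (add_zero i) = 𝟙 _ := by
  refine Eq.trans ?_ (truncπ_truncι (i < k) (K.X i) hi)
  exact congr_arg _ (Cochain.ofHoms_v _ _)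

lemma truncLTSection_comp :
    (truncLTSection K k).comp (Cochain.ofHom (toTruncLT K k)) (add_zero 0) =
      Cochain.ofHom (𝟙 _) := by
  refine (Cochain.ofHoms_comp _ _).trans ?_
  exact congr_arg Cochain.ofHoms (funext fun i => truncι_truncπ _ _)

/-- The short complex of stupid truncations. -/
def truncShortComplex : ShortComplex (CochainComplex (ModuleCat.{u} R) ℤ) :=
  ShortComplex.mk (fromTruncComplex K (c := (k ≤ ·)) (fun i (h : k ≤ i) => by lia))
    (toTruncLT K k) (by
      ext1 i
      change truncι _ _ ≫ truncπ _ _ = 0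
      by_cases h : k ≤ i
      · exact (isZero_truncLT_X K k i h).eq_of_tgt _ _
      · exact (isZero_truncX _ _ h).eq_of_src _ _)

/-- The degreewise splitting of the short complex of stupid truncations. -/
def truncSplitting (i : ℤ) :
    ((truncShortComplex K k).map (HomologicalComplex.eval _ _ i)).Splitting where
  r := truncπ _ _
  s := truncι _ _
  f_r := truncι_truncπ _ _
  s_g := truncι_truncπ _ _
  id := by
    change truncπ (k ≤ i) (K.X i) ≫ truncι _ _ + truncπ (i < k) (K.X i) ≫ truncι _ _ = 𝟙 _
    by_cases h : k ≤ i
    · rw [truncπ_truncι _ _ h, truncπ_truncι_of_not _ _ (by lia), add_zero]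
    · rw [truncπ_truncι_of_not _ _ h, truncπ_truncι _ _ (by lia), zero_add]

lemma truncTriangle_distinguished :
    CochainComplex.trianglehOfDegreewiseSplit (truncShortComplex K k) (truncSplitting K k) ∈
      Pretriangulated.distinguishedTriangles :=
  (HomotopyCategory.distinguished_iff_iso_trianglehOfDegreewiseSplit _).2 ⟨_, _, ⟨Iso.refl _⟩⟩

variable {K}

lemma IsFGProj.truncComplex (hK : IsFGProj K) (c : ℤ → Prop) [DecidablePred c] :
    IsFGProj (truncComplex c K) :=
  fun i => finite_projective_truncX _ _ (hK i)

variable (K)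

lemma isStrictlyLE_truncComplex (c : ℤ → Prop) [DecidablePred c] (N : ℤ) [K.IsStrictlyLE N] :
    (truncComplex c K).IsStrictlyLE N := by
  rw [CochainComplex.isStrictlyLE_iff]
  intro i hi
  have := K.isZero_of_isStrictlyLE N i hi
  refine (IsZero.iff_id_eq_zero _).2 ?_
  change 𝟙 (truncX (c i) (K.X i)) = 0
  rw [← truncι_truncπ, this.eq_of_src (truncπ _ _) 0, comp_zero]

lemma isStrictlyGE_truncGE : (truncGE K k).IsStrictlyGE k := by
  rw [CochainComplex.isStrictlyGE_iff]
  intro i hi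
  exact isZero_truncX _ _ (by lia)

variable {K}

lemma kBounded_truncGE (hK : kMinusB R ((HomotopyCategory.quotient _ _).obj K)) :
    kBounded R ((HomotopyCategory.quotient _ _).obj (truncGE K k)) := by
  obtain ⟨⟨h, N, hN⟩, -⟩ := hK
  change K.IsStrictlyLE N at hN
  exact ⟨h.truncComplex _, k, N, isStrictlyGE_truncGE K k, isStrictlyLE_truncComplex K _ N⟩

lemma kBounded_le_kMinusB : kBounded R ≤ kMinusB R := by
  rintro K ⟨h, m, n, hm, hn⟩
  exact ⟨⟨h, n, hn⟩, m, inferInstance⟩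

/-- The triangle of stupid truncations has its other two vertices with cohomology bounded below,
hence also the third. -/
lemma kMinusB_truncLT (hK : kMinusB R ((HomotopyCategory.quotient _ _).obj K)) :
    kMinusB R ((HomotopyCategory.quotient _ _).obj (truncLT K k)) := by
  refine ⟨?_, (cohomologyBoundedBelow R).ext_of_isTriangulatedClosed₃ _
    (truncTriangle_distinguished K k) (kBounded_le_kMinusB _ (kBounded_truncGE k hK)).2 hK.2⟩
  obtain ⟨⟨h, N, hN⟩, -⟩ := hK
  change K.IsStrictlyLE N at hN
  exact ⟨h.truncComplex _, N, isStrictlyLE_truncComplex K _ N⟩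

end

/-! ### Morphisms in `K^{-,b}(R-proj)` and cocycles -/

section

/-- A complex, as an object of `K^{-,b}(R-proj)`. -/
abbrev kObj (K : CochainComplex (ModuleCat.{u} R) ℤ)
    (hK : kMinusB R ((HomotopyCategory.quotient _ _).obj K)) : KMinusB R := ⟨_, hK⟩

variable {P Q Y : CochainComplex (ModuleCat.{u} R) ℤ}
  (hP : kMinusB R ((HomotopyCategory.quotient _ _).obj P))
  (hQ : kMinusB R ((HomotopyCategory.quotient _ _).obj Q))
  (hY : kMinusB R ((HomotopyCategory.quotient _ _).obj Y))

/-- A morphism of complexes, as a morphism in `K^{-,b}(R-proj)`. -/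
def kMap (f : P ⟶ Q) : kObj P hP ⟶ kObj Q hQ :=
  ObjectProperty.homMk ((HomotopyCategory.quotient _ _).map f)

lemma kMap_surjective : Function.Surjective (kMap hP hQ) := fun g => by
  obtain ⟨f, hf⟩ := (HomotopyCategory.quotient _ _).map_surjective g.hom
  exact ⟨f, ObjectProperty.hom_ext _ hf⟩

/-- The comparison of shifts in `K^{-,b}(R-proj)` and of complexes. -/
def kShiftIso (n : ℤ) :
    (HomotopyCategory.quotient _ _).obj (Q⟦n⟧) ≅ ((kObj Q hQ)⟦n⟧).obj :=
  ((HomotopyCategory.quotient _ _).commShiftIso n).app Q ≪≫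
    (((kMinusB R).ι.commShiftIso n).app (kObj Q hQ)).symm

lemma kShiftIso_hom_naturality (s : Q ⟶ Y) (n : ℤ) :
    (kShiftIso hQ n).hom ≫ ((kMap hQ hY s)⟦n⟧').hom =
      (HomotopyCategory.quotient _ _).map (s⟦n⟧') ≫ (kShiftIso hY n).hom := by
  have h₁ := (kMinusB R).ι.commShiftIso_inv_naturality (kMap hQ hY s) n
  have h₂ := (HomotopyCategory.quotient (ModuleCat.{u} R) (.up ℤ)).commShiftIso_hom_naturality s n
  dsimp only [kShiftIso, Iso.trans_hom, Iso.app_hom, Iso.symm_hom, Iso.app_inv]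
  rw [Category.assoc, reassoc_of% h₂]
  exact congr_arg _ h₁.symm

/-- The morphism `P ⟶ Q⟦n⟧` in `K^{-,b}(R-proj)` given by a cocycle. -/
def kHom (n : ℤ) : Cocycle P Q n →+ (kObj P hP ⟶ (kObj Q hQ)⟦n⟧) :=
  AddMonoidHom.mk' (fun z => ObjectProperty.homMk
    (CohomologyClass.toHom (CohomologyClass.mk z) ≫ (kShiftIso hQ n).hom)) (fun z z' => by
      rw [CohomologyClass.mk_add, map_add, Preadditive.add_comp]
      rfl)

variable {n : ℤ}

lemma kHom_surjective : Function.Surjective (kHom hP hQ n) := fun g => by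
  obtain ⟨x, hx⟩ := (CohomologyClass.toHom_bijective P Q n).2 (g.hom ≫ (kShiftIso hQ n).inv)
  obtain ⟨z, rfl⟩ := x.mk_surjective
  refine ⟨z, ObjectProperty.hom_ext _ ?_⟩
  change CohomologyClass.toHom (CohomologyClass.mk z) ≫ (kShiftIso hQ n).hom = _
  rw [hx, Category.assoc, Iso.inv_hom_id, Category.comp_id]

/-- A morphism in the homotopy category vanishes exactly when its cocycle is a coboundary; with
`kHom_surjective` this identifies Hom in K^{-,b}(R-proj) with the cohomology of Hom(P, Q). -/
lemma kHom_eq_zero_iff (z : Cocycle P Q n) : kHom hP hQ n z = 0 ↔ z ∈ coboundaries P Q n := by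
  rw [← CohomologyClass.toHom_mk_eq_zero_iff]
  constructor
  · intro h
    have h' : CohomologyClass.toHom (CohomologyClass.mk z) ≫ (kShiftIso hQ n).hom = 0 :=
      congr_arg (fun g : kObj P hP ⟶ (kObj Q hQ)⟦n⟧ => g.hom) h
    rw [← cancel_mono (kShiftIso hQ n).hom, h', zero_comp]
  · intro h
    refine ObjectProperty.hom_ext _ ?_
    change CohomologyClass.toHom (CohomologyClass.mk z) ≫ (kShiftIso hQ n).hom = 0
    rw [h, zero_comp]

lemma kMap_comp_kHom (f : P ⟶ Q) (z : Cocycle Q Y n) :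
    kMap hP hQ f ≫ kHom hQ hY n z = kHom hP hY n (z.precomp f) := by
  refine ObjectProperty.hom_ext _ ?_
  change (HomotopyCategory.quotient _ _).map f ≫ CohomologyClass.toHom (CohomologyClass.mk z) ≫ _ =
    CohomologyClass.toHom (CohomologyClass.mk (z.precomp f)) ≫ _
  rw [CohomologyClass.toHom_mk, CohomologyClass.toHom_mk, Cocycle.equivHomShift_symm_precomp,
    Functor.map_comp, Category.assoc]

lemma kHom_comp_kMap (z : Cocycle P Q n) (s : Q ⟶ Y) :
    kHom hP hQ n z ≫ (kMap hQ hY s)⟦n⟧' = kHom hP hY n (z.postcomp s) := by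
  refine ObjectProperty.hom_ext _ ?_
  change (CohomologyClass.toHom (CohomologyClass.mk z) ≫ (kShiftIso hQ n).hom) ≫
    ((kMap hQ hY s)⟦n⟧').hom = CohomologyClass.toHom (CohomologyClass.mk (z.postcomp s)) ≫ _
  rw [CohomologyClass.toHom_mk, CohomologyClass.toHom_mk, Cocycle.equivHomShift_symm_postcomp,
    Functor.map_comp, Category.assoc, Category.assoc, kShiftIso_hom_naturality]

lemma kMap_comp (f : P ⟶ Q) (g : Q ⟶ Y) :
    kMap hP hY (f ≫ g) = kMap hP hQ f ≫ kMap hQ hY g :=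
  ObjectProperty.hom_ext _ (by
    change (HomotopyCategory.quotient _ _).map (f ≫ g) =
      (HomotopyCategory.quotient _ _).map f ≫ (HomotopyCategory.quotient _ _).map g
    exact Functor.map_comp _ _ _)

/-! ### Perfect complexes, bounded cochains and cofinality of the truncations -/

lemma exists_iso_of_perfect {X : KMinusB R} (hX : perfect R X) :
    ∃ (K : CochainComplex (ModuleCat.{u} R) ℤ)
      (hK : kMinusB R ((HomotopyCategory.quotient _ _).obj K)) (m : ℤ),
      K.IsStrictlyGE m ∧ Nonempty (X ≅ kObj K hK) := by
  obtain ⟨K, hK, ⟨e⟩⟩ := hX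
  obtain ⟨K : CochainComplex _ _, rfl⟩ := K.quotient_obj_surjective
  have hK' := kBounded_le_kMinusB _ hK
  obtain ⟨-, m, -, hm, -⟩ := hK
  exact ⟨K, hK', m, hm, ⟨ObjectProperty.isoMk _ e⟩⟩

/-- A cochain from a bounded below complex vanishes in all sufficiently small degrees. -/
lemma mem_boundedCochain_of_isStrictlyGE (m : ℤ) [P.IsStrictlyGE m] (z : Cochain P Q n) :
    z ∈ boundedCochain P Q n :=
  -- If q < m + n then the source degree p = q - n is below m, where P is zero.
  ⟨m + n, fun p _ _ _ => (P.isZero_of_isStrictlyGE m p (by lia)).eq_of_src _ _⟩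

/-- The projection to the stupid truncation, in `K^{-,b}(R-proj)`. -/
def kTrunc (k : ℤ) : kObj Q hQ ⟶ kObj (truncLT Q k) (kMinusB_truncLT k hQ) :=
  kMap _ _ (toTruncLT Q k)

/-- The fibre is the truncation in degrees ≥ k, which is bounded because Q is bounded above. So the
projection becomes invertible in D_sg. -/
lemma trW_kTrunc (k : ℤ) : (perfect R).trW (kTrunc hQ k) := by
  refine ((kBounded R).isoClosure.inverseImage_trW_iff (kMinusB R).ι _).2 ?_
  rw [ObjectProperty.trW_isoClosure]
  exact ObjectProperty.trW.mk' _ (truncTriangle_distinguished Q k) (kBounded_truncGE k hQ)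

lemma comp_toTruncLT_eq_zero_iff (z : Cochain P Q n) (k : ℤ) :
    z.comp (Cochain.ofHom (toTruncLT Q k)) (add_zero n) = 0 ↔
      ∀ (p q : ℤ) (h : p + n = q), q < k → z.v p q h = 0 := by
  constructor
  · intro h p q hpq hq
    have := Cochain.congr_v h p q hpq
    rw [Cochain.comp_zero_cochain_v, Cochain.ofHom_v, Cochain.zero_v] at this
    rw [← Category.comp_id (z.v p q hpq), ← isIso_toTruncLT_f Q k q hq, reassoc_of% this,
      zero_comp]
  · intro h
    ext p q hpq : 1
    rw [Cochain.comp_zero_cochain_v, Cochain.ofHom_v, Cochain.zero_v]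
    by_cases hq : q < k
    · rw [h p q hpq hq, zero_comp]
    · exact (isZero_truncLT_X Q k q (by lia)).eq_of_tgt _ _

lemma mem_boundedCochain_iff_comp_toTruncLT (z : Cochain P Q n) :
    z ∈ boundedCochain P Q n ↔
      ∃ k, z.comp (Cochain.ofHom (toTruncLT Q k)) (add_zero n) = 0 :=
  exists_congr fun k => (comp_toTruncLT_eq_zero_iff z k).symm

/-- A morphism from a perfect complex to `Q⟦n⟧` becomes zero in some stupid truncation of `Q`. -/
lemma exists_comp_kTrunc_eq_zero {X : KMinusB R} (hX : perfect R X) (f : X ⟶ (kObj Q hQ)⟦n⟧) :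
    ∃ k, f ≫ (kTrunc hQ k)⟦n⟧' = 0 := by
  obtain ⟨K, hK, m, hm, ⟨e⟩⟩ := exists_iso_of_perfect hX
  obtain ⟨z, hz⟩ := kHom_surjective hK hQ (e.inv ≫ f)
  obtain ⟨k, hk⟩ := (mem_boundedCochain_iff_comp_toTruncLT z.1).1
    (mem_boundedCochain_of_isStrictlyGE m z.1)
  refine ⟨k, ?_⟩
  rw [← cancel_epi e.inv, comp_zero, ← Category.assoc, ← hz, kTrunc, kHom_comp_kMap]
  rw [show z.postcomp (toTruncLT Q k) = 0 from Cocycle.ext hk, map_zero]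

/-- A morphism `P ⟶ Q⟦n⟧` which factors through a perfect complex is given by a cocycle which
vanishes in all sufficiently small degrees. -/
lemma exists_boundedCocycle_of_perfect {X : KMinusB R} (hX : perfect R X) (a : kObj P hP ⟶ X)
    (b : X ⟶ (kObj Q hQ)⟦n⟧) : ∃ z ∈ boundedCocycle P Q n, kHom hP hQ n z = a ≫ b := by
  obtain ⟨K, hK, m, hm, ⟨e⟩⟩ := exists_iso_of_perfect hX
  obtain ⟨z, hz⟩ := kHom_surjective hK hQ (e.inv ≫ b)
  obtain ⟨f, hf⟩ := kMap_surjective hP hK (a ≫ e.hom)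
  refine ⟨z.precomp f, ?_, ?_⟩
  · obtain ⟨k, hk⟩ := mem_boundedCochain_of_isStrictlyGE m z.1
    refine ⟨k, fun p q h hq => ?_⟩
    refine (Cochain.zero_cochain_comp_v _ _ p q h).trans ?_
    rw [hk p q h hq, comp_zero]
  · rw [← kMap_comp_kHom hP hK hQ, hf, hz, Category.assoc, Iso.hom_inv_id_assoc]

end

/-! ### Morphisms in the singularity category and cochains -/

section

variable {P Q : CochainComplex (ModuleCat.{u} R) ℤ}
  (hP : kMinusB R ((HomotopyCategory.quotient _ _).obj P))
  (hQ : kMinusB R ((HomotopyCategory.quotient _ _).obj Q)) {n : ℤ}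

variable (P Q) in
/-- Composition of cochains with the projection to a stupid truncation. -/
def compToTruncLT (k n : ℤ) : Cochain P Q n →+ Cochain P (truncLT Q k) n :=
  AddMonoidHom.mk' (fun z => z.comp (Cochain.ofHom (toTruncLT Q k)) (add_zero n))
    fun _ _ => Cochain.add_comp _ _ _ _

lemma mem_boundedCochain_iff_compToTruncLT (z : Cochain P Q n) :
    z ∈ boundedCochain P Q n ↔ ∃ k, compToTruncLT P Q k n z = 0 :=
  mem_boundedCochain_iff_comp_toTruncLT z

lemma δ_compToTruncLT (k n m : ℤ) (z : Cochain P Q n) :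
    δ n m (compToTruncLT P Q k n z) = compToTruncLT P Q k m (δ n m z) :=
  δ_comp_ofHom _ _ _

lemma compToTruncLT_truncLTMap {k k' : ℤ} (h : k' ≤ k) (z : Cochain P Q n) :
    (compToTruncLT P Q k n z).comp (Cochain.ofHom (truncLTMap Q h)) (add_zero n) =
      compToTruncLT P Q k' n z := by
  refine (Cochain.comp_assoc_of_third_is_zero_cochain z (Cochain.ofHom (toTruncLT Q k))
    (Cochain.ofHom (truncLTMap Q h)) (add_zero n)).trans ?_
  rw [← Cochain.ofHom_comp, toTruncLT_truncLTMap]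
  rfl

/-- The section is a cochain of degree 0 and need not commute with differentials; it still lifts
every cochain into the truncation to one into Q, with an error in the differential that the
truncation kills. -/
lemma compToTruncLT_truncLTSection (k : ℤ) (z : Cochain P (truncLT Q k) n) :
    compToTruncLT P Q k n (z.comp (truncLTSection Q k) (add_zero n)) = z := by
  refine (Cochain.comp_assoc_of_third_is_zero_cochain z (truncLTSection Q k)
    (Cochain.ofHom (toTruncLT Q k)) (add_zero n)).trans ?_
  rw [truncLTSection_comp, Cochain.comp_id]

lemma compToTruncLT_eq_zero_of_le {k k' : ℤ} (h : k' ≤ k) (z : Cochain P Q n)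
    (hz : compToTruncLT P Q k n z = 0) : compToTruncLT P Q k' n z = 0 := by
  rw [← compToTruncLT_truncLTMap h, hz, Cochain.zero_comp]

lemma mem_boundedCochain_of_compToTruncLT (k : ℤ) (z : Cochain P Q n)
    (hz : compToTruncLT P Q k n z ∈ boundedCochain P (truncLT Q k) n) :
    z ∈ boundedCochain P Q n := by
  obtain ⟨j, hj⟩ := hz
  -- Below k the projection to the truncation is injective on components, and below j the truncated
  -- cochain vanishes.
  refine ⟨min j k, fun p q h hq => ?_⟩
  have h₁ := hj p q h (by lia)
  replace h₁ : z.v p q h ≫ (toTruncLT Q k).f q = 0 := by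
    rw [← h₁]
    refine (Eq.trans (Cochain.comp_zero_cochain_v _ _ p q h) ?_).symm
    rw [Cochain.ofHom_v]
  rw [← Category.comp_id (z.v p q h), ← isIso_toTruncLT_f Q k q (by lia), reassoc_of% h₁,
    zero_comp]

/-- The morphism `φ : P ⟶ Q⟦n⟧` in `D_sg(R)` becomes, in the stupid truncation of `Q` in degrees
`< k`, the morphism given by the cochain `z`, which becomes a cocycle there. -/
def SingRelAt (k : ℤ) (z : Cochain P Q n)
    (φ : (quotientFunctor R).obj (kObj P hP) ⟶ (quotientFunctor R).obj ((kObj Q hQ)⟦n⟧)) : Prop :=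
  ∃ c : Cocycle P (truncLT Q k) n, c.1 = compToTruncLT P Q k n z ∧
    φ ≫ (quotientFunctor R).map ((kTrunc hQ k)⟦n⟧') =
      (quotientFunctor R).map (kHom hP (kMinusB_truncLT k hQ) n c)

variable {hP hQ}

lemma SingRelAt.of_le {k k' : ℤ} (h : k' ≤ k) {z : Cochain P Q n}
    {φ : (quotientFunctor R).obj (kObj P hP) ⟶ (quotientFunctor R).obj ((kObj Q hQ)⟦n⟧)}
    (hz : SingRelAt hP hQ k z φ) : SingRelAt hP hQ k' z φ := by
  obtain ⟨c, hc, hφ⟩ := hz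
  refine ⟨c.postcomp (truncLTMap Q h), ?_, ?_⟩
  · rw [← compToTruncLT_truncLTMap h, ← hc]
    rfl
  · have h₁ : kTrunc hQ k' = kTrunc hQ k ≫ kMap (kMinusB_truncLT k hQ) (kMinusB_truncLT k' hQ)
        (truncLTMap Q h) := by
      rw [kTrunc, kTrunc, ← kMap_comp, toTruncLT_truncLTMap]
    rw [h₁, Functor.map_comp, Functor.map_comp, reassoc_of% hφ, ← Functor.map_comp,
      kHom_comp_kMap]

lemma isIso_map_kTrunc (k : ℤ) :
    IsIso ((quotientFunctor R).map ((kTrunc hQ k)⟦n⟧')) :=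
  Localization.inverts (quotientFunctor R) (perfect R).trW _
    ((perfect R).trW.shift (trW_kTrunc hQ k) n)

variable (hP hQ n)

/-- The relation between cochains of degree `n` and morphisms `P ⟶ Q⟦n⟧` in `D_sg(R)`. -/
def singRel : AddSubgroup (Cochain P Q n ×
    ((quotientFunctor R).obj (kObj P hP) ⟶ (quotientFunctor R).obj ((kObj Q hQ)⟦n⟧))) where
  carrier := {x | ∃ k, SingRelAt hP hQ k x.1 x.2}
  zero_mem' := ⟨0, 0, (map_zero _).symm, by
    rw [map_zero, Functor.map_zero]
    exact zero_comp⟩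
  add_mem' := by
    rintro x y ⟨k, hk⟩ ⟨k', hk'⟩
    obtain ⟨c, hc, hφ⟩ := hk.of_le (min_le_left k k')
    obtain ⟨c', hc', hφ'⟩ := hk'.of_le (min_le_right k k')
    refine ⟨min k k', c + c', ?_, ?_⟩
    · refine Eq.trans ?_ (map_add _ _ _).symm
      rw [← hc, ← hc']
      rfl
    · rw [map_add, Functor.map_add, ← hφ, ← hφ']
      exact Preadditive.add_comp _ _ _ _ _ _
  neg_mem' := by
    rintro x ⟨k, c, hc, hφ⟩
    refine ⟨k, -c, ?_, ?_⟩
    · refine Eq.trans ?_ (map_neg _ _).symm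
      rw [← hc]
      rfl
    · rw [map_neg, Functor.map_neg, ← hφ]
      exact Preadditive.neg_comp _ _

variable {n}

/-- For k small, δ z dies in the truncation, so z becomes a cocycle there; φ is the resulting roof
with the projection of Q inverted. -/
lemma exists_singRel_of_δ_mem (z : Cochain P Q n) (m : ℤ) (hm : n + 1 = m)
    (hz : δ n m z ∈ boundedCochain P Q m) : ∃ φ, (z, φ) ∈ singRel hP hQ n := by
  obtain ⟨k, hk⟩ := (mem_boundedCochain_iff_compToTruncLT _).1 hz
  have := isIso_map_kTrunc (n := n) (hQ := hQ) k
  let c : Cocycle P (truncLT Q k) n := Cocycle.mk (compToTruncLT P Q k n z) m hm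
    ((δ_compToTruncLT k n m z).trans hk)
  refine ⟨(quotientFunctor R).map (kHom hP (kMinusB_truncLT k hQ) n c) ≫
    inv ((quotientFunctor R).map ((kTrunc hQ k)⟦n⟧')), k, c, rfl, ?_⟩
  exact (Category.assoc _ _ _).trans (by rw [IsIso.inv_hom_id, Category.comp_id])

lemma exists_singRel
    (φ : (quotientFunctor R).obj (kObj P hP) ⟶ (quotientFunctor R).obj ((kObj Q hQ)⟦n⟧)) :
    ∃ z, (z, φ) ∈ singRel hP hQ n := by
  obtain ⟨f, hf⟩ := Localization.exists_leftFraction (quotientFunctor R) (perfect R).trW φ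
  have hφ : φ ≫ (quotientFunctor R).map f.s = (quotientFunctor R).map f.f := by
    rw [hf, MorphismProperty.LeftFraction.map_comp_map_s]
  -- Cofinality: the fibre X of the denominator is perfect, so X ⟶ Σⁿ Q dies in some truncation, and
  -- the projection to that truncation factors through the denominator. The fraction can thus be
  -- rewritten with the projection as denominator.
  obtain ⟨X, a, b, hT, hX⟩ := ((perfect R).trW_iff' f.s).1 f.hs
  obtain ⟨k, hk⟩ := exists_comp_kTrunc_eq_zero hQ hX a
  obtain ⟨g, hg⟩ := Pretriangulated.Triangle.yoneda_exact₂ _ hT _ hk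
  change f.Y' ⟶ _ at g
  change _ = f.s ≫ g at hg
  obtain ⟨c, hc⟩ := kHom_surjective hP (kMinusB_truncLT k hQ) (f.f ≫ g)
  refine ⟨c.1.comp (truncLTSection Q k) (add_zero n), k, c,
    (compToTruncLT_truncLTSection k c.1).symm, ?_⟩
  change φ ≫ _ = _
  rw [hc, hg, Functor.map_comp, Functor.map_comp, ← hφ, Category.assoc]

variable {hP hQ}

lemma δ_mem_boundedCochain_of_singRel {z : Cochain P Q n}
    {φ : (quotientFunctor R).obj (kObj P hP) ⟶ (quotientFunctor R).obj ((kObj Q hQ)⟦n⟧)}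
    (h : (z, φ) ∈ singRel hP hQ n) (m : ℤ) : δ n m z ∈ boundedCochain P Q m := by
  obtain ⟨k, c, hc, -⟩ := h
  refine (mem_boundedCochain_iff_compToTruncLT _).2 ⟨k, ?_⟩
  rw [← δ_compToTruncLT]
  refine (congr_arg _ hc.symm).trans (Cocycle.δ_eq_zero c m)

/-- A morphism of K^{-,b}(R-proj) that vanishes in D_sg factors through a perfect complex, hence is
represented by a bounded cocycle; the representing cocycle differs from it by a coboundary. -/
lemma exists_of_singRel_zero {z : Cochain P Q n} (h : (z, 0) ∈ singRel hP hQ n) (m : ℤ)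
    (hm : m + 1 = n) : ∃ y : Cochain P Q m, z - δ m n y ∈ boundedCochain P Q n := by
  obtain ⟨k, c, hc, hφ⟩ := h
  replace hφ : (quotientFunctor R).map (kHom hP (kMinusB_truncLT k hQ) n c) =
      (quotientFunctor R).map 0 := by
    rw [← hφ, Functor.map_zero]
    exact zero_comp
  obtain ⟨Y, s, hs, h₁⟩ := (MorphismProperty.map_eq_iff_postcomp (quotientFunctor R)
    (perfect R).trW _ _).1 hφ
  rw [zero_comp] at h₁
  obtain ⟨X, a, b, hT, hX⟩ := ((perfect R).trW_iff' s).1 hs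
  obtain ⟨g, hg⟩ := Pretriangulated.Triangle.coyoneda_exact₂ _ hT _ h₁
  change kObj P hP ⟶ X at g
  change _ = g ≫ a at hg
  obtain ⟨w, hw, hwg⟩ := exists_boundedCocycle_of_perfect hP (kMinusB_truncLT k hQ) hX g a
  have h₂ : kHom hP (kMinusB_truncLT k hQ) n (c - w) = 0 := by
    rw [map_sub, hwg, hg, sub_self]
  rw [kHom_eq_zero_iff, mem_coboundaries_iff _ m hm] at h₂
  obtain ⟨y, hy⟩ := h₂
  -- The homotopy y lives in the truncation and is lifted by the degreewise section. After
  -- truncation the difference is c - (c - w) = w, which is bounded.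
  refine ⟨y.comp (truncLTSection Q k) (add_zero m), mem_boundedCochain_of_compToTruncLT k _ ?_⟩
  rw [map_sub, ← δ_compToTruncLT, compToTruncLT_truncLTSection, hy, ← hc]
  change c.1 - (c.1 - w.1) ∈ _
  rw [sub_sub_cancel]
  exact hw

variable (hP hQ)

lemma singRel_kHom (z : Cocycle P Q n) :
    (z.1, (quotientFunctor R).map (kHom hP hQ n z)) ∈ singRel hP hQ n := by
  -- Any truncation level would do, since z is already a cocycle in Q.
  refine ⟨0, z.postcomp (toTruncLT Q 0), rfl, ?_⟩
  rw [← kHom_comp_kMap hP hQ, Functor.map_comp]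
  rfl

variable {hP hQ}

/-- In a deep enough truncation z is zero, so φ vanishes after composition with a projection that is
invertible in D_sg. -/
lemma eq_zero_of_singRel_of_mem_boundedCochain {z : Cochain P Q n}
    {φ : (quotientFunctor R).obj (kObj P hP) ⟶ (quotientFunctor R).obj ((kObj Q hQ)⟦n⟧)}
    (h : (z, φ) ∈ singRel hP hQ n) (hz : z ∈ boundedCochain P Q n) : φ = 0 := by
  obtain ⟨k, hk⟩ := h
  obtain ⟨k', hk'⟩ := (mem_boundedCochain_iff_compToTruncLT _).1 hz
  obtain ⟨c, hc, hφ⟩ := hk.of_le (min_le_left k k')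
  have := isIso_map_kTrunc (n := n) (hQ := hQ) (min k k')
  rw [compToTruncLT_eq_zero_of_le (min_le_right k k') z hk'] at hc
  obtain rfl : c = 0 := Cocycle.ext hc
  rw [map_zero, Functor.map_zero] at hφ
  exact (cancel_mono ((quotientFunctor R).map ((kTrunc hQ (min k k'))⟦n⟧'))).1
    (hφ.trans zero_comp.symm)

lemma eq_map_of_singRel {z : Cochain P Q n}
    {φ : (quotientFunctor R).obj (kObj P hP) ⟶ (quotientFunctor R).obj ((kObj Q hQ)⟦n⟧)}
    (h : (z, φ) ∈ singRel hP hQ n) (c : Cocycle P Q n) (hc : z - c.1 ∈ boundedCochain P Q n) :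
    φ = (quotientFunctor R).map (kHom hP hQ n c) :=
  sub_eq_zero.1 (eq_zero_of_singRel_of_mem_boundedCochain (sub_mem h (singRel_kHom hP hQ c)) hc)

end

/-! ### The exact sequence for complexes -/

section

variable {P Q : CochainComplex (ModuleCat.{u} R) ℤ}
  (hP : kMinusB R ((HomotopyCategory.quotient _ _).obj P))
  (hQ : kMinusB R ((HomotopyCategory.quotient _ _).obj Q))

lemma addMonoidHom_exists_lift {A B C : Type*} [AddGroup A] [AddGroup B] [AddGroup C]
    (f : A →+ B) (hf : Function.Surjective f) (g : A →+ C) (h : ∀ a, f a = 0 → g a = 0) :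
    ∃ l : B →+ C, ∀ a, l (f a) = g a :=
  ⟨f.liftOfSurjective hf ⟨g, h⟩, fun a => f.liftOfRightInverse_comp_apply _ _ ⟨g, h⟩ a⟩

/-- The long exact sequence relating the homology of `P^* ⊗_R Q` to the morphisms in
`K^{-,b}(R-proj)` and in `D_sg(R)`. -/
theorem exists_longExactSequence :
    ∃ (α : ∀ n : ℤ, (tensorComplex (dualComplex P) Q).homology n →+
        (kObj P hP ⟶ (kObj Q hQ)⟦n⟧))
      (δ : ∀ n : ℤ, ((quotientFunctor R).obj (kObj P hP) ⟶
        (quotientFunctor R).obj ((kObj Q hQ)⟦n⟧)) →+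
          (tensorComplex (dualComplex P) Q).homology (n + 1)),
      (∀ n : ℤ, Function.Exact (α n)
        ((quotientFunctor R).mapAddHom : (kObj P hP ⟶ (kObj Q hQ)⟦n⟧) →+ _)) ∧
      (∀ n : ℤ, Function.Exact
        ((quotientFunctor R).mapAddHom : (kObj P hP ⟶ (kObj Q hQ)⟦n⟧) →+ _) (δ n)) ∧
      (∀ n : ℤ, Function.Exact (δ n) (α (n + 1))) := by
  obtain ⟨⟨hP', N, hN⟩, -⟩ := id hP
  change P.IsStrictlyLE N at hN
  choose c hc hc₀ using fun n => exists_boundedCocycle_toHomology (P := P) (Q := Q) hP' N n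
  replace hc₀ (m n : ℤ) (h : m + 1 = n) (w : boundedCocycle P Q n) :
      c n w = 0 ↔ ∃ y ∈ boundedCochain P Q m, CochainComplex.HomComplex.δ m n y = w.1.1 := by
    obtain rfl : m = n - 1 := by lia
    exact hc₀ n w
  -- α is induced by the inclusion of bounded cochains into all cochains.
  have hα (n : ℤ) := addMonoidHom_exists_lift (c n) (hc n)
    ((kHom hP hQ n).comp (boundedCocycle P Q n).subtype) (fun w hw => by
      obtain ⟨y, -, hy⟩ := (hc₀ (n - 1) n (by lia) w).1 hw
      exact (kHom_eq_zero_iff hP hQ w.1).2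
        ((mem_coboundaries_iff _ (n - 1) (by lia)).2 ⟨y, hy⟩))
  choose α hα using hα
  -- The connecting map sends φ, represented by z, to the class of the bounded cocycle δ z.
  let σ (n : ℤ) : singRel hP hQ n →+ boundedCocycle P Q (n + 1) := AddMonoidHom.mk'
    (fun x => ⟨Cocycle.mk (CochainComplex.HomComplex.δ n (n + 1) x.1.1) _ rfl (δ_δ _ _ _ _),
      δ_mem_boundedCochain_of_singRel x.2 _⟩)
    (fun x y => Subtype.ext (Cocycle.ext (δ_add _ _ _ _)))
  have hδ (n : ℤ) := addMonoidHom_exists_lift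
    ((AddMonoidHom.snd _ _).comp (singRel hP hQ n).subtype)
    (fun φ => by
      obtain ⟨z, hz⟩ := exists_singRel hP hQ φ
      exact ⟨⟨_, hz⟩, rfl⟩) ((c (n + 1)).comp (σ n)) (by
      rintro ⟨⟨z, φ⟩, hz⟩ (rfl : φ = 0)
      -- Independence of the representative: if φ = 0, then z - δ y is bounded and has the same
      -- differential as z, so δ z is the coboundary of a bounded cochain.
      obtain ⟨y, hy⟩ := exists_of_singRel_zero hz (n - 1) (by lia)
      refine (hc₀ n _ rfl _).2 ⟨_, hy, ?_⟩
      rw [δ_sub, δ_δ, sub_zero]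
      rfl)
  choose d hd using hδ
  replace hd (n : ℤ) (z φ) (h : (z, φ) ∈ singRel hP hQ n) :
      d n φ = c (n + 1) (σ n ⟨(z, φ), h⟩) := hd n ⟨(z, φ), h⟩
  replace hα (n : ℤ) (w : boundedCocycle P Q n) : α n (c n w) = kHom hP hQ n w.1 := hα n w
  refine ⟨α, d, fun n f => ⟨fun hf => ?_, ?_⟩, fun n φ => ⟨fun hφ => ?_, ?_⟩,
    fun n x => ⟨fun hx => ?_, ?_⟩⟩
  · obtain ⟨z, rfl⟩ := kHom_surjective hP hQ f
    have h := singRel_kHom hP hQ z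
    rw [show (quotientFunctor R).map (kHom hP hQ n z) = 0 from hf] at h
    obtain ⟨y, hy⟩ := exists_of_singRel_zero h (n - 1) (by lia)
    -- The cocycle z is cohomologous to the bounded cocycle z - δ y, which gives the preimage under
    -- α.
    let y' : Cocycle P Q n := Cocycle.mk (CochainComplex.HomComplex.δ (n - 1) n y) _ rfl
      (δ_δ _ _ _ _)
    refine ⟨c n ⟨z - y', hy⟩, ?_⟩
    rw [hα]
    refine (map_sub _ _ _).trans ?_
    rw [(kHom_eq_zero_iff hP hQ y').2 ((mem_coboundaries_iff _ (n - 1) (by lia)).2 ⟨y, rfl⟩),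
      sub_zero]
  · rintro ⟨x, rfl⟩
    obtain ⟨w, rfl⟩ := hc n x
    rw [hα]
    exact eq_zero_of_singRel_of_mem_boundedCochain (singRel_kHom hP hQ w.1) w.2
  · obtain ⟨z, hz⟩ := exists_singRel hP hQ φ
    rw [hd n z φ hz] at hφ
    -- Here δ z = δ y with y bounded, so z - y is an honest cocycle into Q representing the same φ.
    obtain ⟨y, hy, hyz⟩ := (hc₀ n _ rfl _).1 hφ
    let w : Cocycle P Q n := Cocycle.mk (z - y) _ rfl (by
      rw [δ_sub, hyz]
      exact sub_self _)
    refine ⟨kHom hP hQ n w, (eq_map_of_singRel hz w ?_).symm⟩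
    change z - (z - y) ∈ _
    rwa [sub_sub_cancel]
  · rintro ⟨f, rfl⟩
    obtain ⟨z, rfl⟩ := kHom_surjective hP hQ f
    refine (hd n _ _ (singRel_kHom hP hQ z)).trans ((hc₀ n _ rfl _).2 ⟨0, zero_mem _, ?_⟩)
    rw [δ_zero]
    exact (Cocycle.δ_eq_zero z _).symm
  · obtain ⟨w, rfl⟩ := hc (n + 1) x
    rw [hα, kHom_eq_zero_iff, mem_coboundaries_iff _ n rfl] at hx
    obtain ⟨z, hz⟩ := hx
    -- The bounded cocycle w is δ z for some cochain z, perhaps unbounded; z is then a cocycle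
    -- modulo bounded cochains and defines φ.
    obtain ⟨φ, hφ⟩ := exists_singRel_of_δ_mem hP hQ z _ rfl (hz ▸ w.2)
    refine ⟨φ, (hd n z φ hφ).trans (congr_arg _ (Subtype.ext (Cocycle.ext hz)))⟩
  · rintro ⟨φ, rfl⟩
    obtain ⟨z, hz⟩ := exists_singRel hP hQ φ
    rw [hd n z φ hz, hα, kHom_eq_zero_iff, mem_coboundaries_iff _ n rfl]
    exact ⟨z, rfl⟩

end

/-! ### Comparison with the Ext groups -/

section

variable [HasDerivedCategory.{w} (ModuleCat.{u} R)] {M N : ModuleCat.{u} R}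
  (P : FGProjectiveResolution M) (Q : FGProjectiveResolution N) (n : ℤ)

lemma toDerived_map_bijective (Y : KMinusB R) :
    Function.Bijective ((toDerived R).map : (P.toKMinusB ⟶ Y) → _) := by
  have h : Function.Bijective (DerivedCategory.Qh.map :
      ((HomotopyCategory.quotient _ _).obj P.toProjectiveResolution.cochainComplex ⟶ Y.obj) → _) :=
    -- A bounded above complex of projectives is K-projective.
    CochainComplex.IsKProjective.Qh_map_bijective _ _
  exact h.comp (kMinusB R).fullyFaithfulι.homEquiv.bijective

/-- The canonical isomorphism `Hom_{K^{-,b}(R-proj)}(P, Σⁿ Q) ≃ Extⁿ_R(M, N)`. -/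
def toExtGroupEquiv : ShiftedHom P.toKMinusB Q.toKMinusB n ≃+ ExtGroup M N n :=
  AddEquiv.ofBijective (AddMonoidHom.mk' (toExtGroup P Q) (fun f g => by
    dsimp only [toExtGroup]
    rw [ShiftedHom.map_add, Preadditive.add_comp, Preadditive.comp_add])) (by
    have h := toDerived_map_bijective P (Q.toKMinusB⟦n⟧)
    let e : ((toDerived R).obj P.toKMinusB ⟶ (toDerived R).obj (Q.toKMinusB⟦n⟧)) ≃
        ExtGroup M N n :=
      Iso.homCongr P.augmentation (((toDerived R).commShiftIso n).app Q.toKMinusB ≪≫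
        (shiftFunctor _ n).mapIso Q.augmentation)
    convert e.bijective.comp h using 1
    ext f
    change P.augmentation.inv ≫ ((toDerived R).map f ≫ _) ≫ _ =
      P.augmentation.inv ≫ (toDerived R).map f ≫ _ ≫ _
    rw [Category.assoc]
    rfl)

end

section

variable {M N : ModuleCat.{u} R}
  (P : FGProjectiveResolution M) (Q : FGProjectiveResolution N) (n : ℤ)

/-- Morphisms `M ⟶ Σⁿ N` in `D_sg(R)` in terms of the shift on `K^{-,b}(R-proj)`. -/
def singShiftEquiv :
    (P.toDSing ⟶ (quotientFunctor R).obj (Q.toKMinusB⟦n⟧)) ≃+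
      ShiftedHom P.toDSing Q.toDSing n :=
  AddEquiv.ofBijective
    (Preadditive.rightComp P.toDSing (((quotientFunctor R).commShiftIso n).hom.app Q.toKMinusB))
    (((quotientFunctor R).commShiftIso n).app Q.toKMinusB).homToEquiv.bijective

variable {n} in
/-- The hyper-Tor groups in terms of the homology groups in the opposite degree. -/
def hyperTorEquiv {i : ℤ} (h : -i = n) :
    (tensorComplex P.rhomDual Q.toProjectiveResolution.cochainComplex).homology n ≃+
      hyperTor P.rhomDual Q i := by
  subst h
  exact AddEquiv.refl _

end

/-- An exact sequence in which the term before and the third term vanish yields a bijection. -/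
lemma bijective_of_exact_of_subsingleton {A B C D : Type*} [AddGroup A] [AddGroup B] [AddGroup C]
    [AddGroup D] [Subsingleton A] [Subsingleton D] {f : A →+ B} {g : B →+ C} {h : C →+ D}
    (hfg : Function.Exact f g) (hgh : Function.Exact g h) : Function.Bijective g := by
  refine ⟨(injective_iff_map_eq_zero g).2 fun b hb => ?_,
    fun c => (hgh c).1 (Subsingleton.elim _ _)⟩
  obtain ⟨a, rfl⟩ := (hfg b).1 hb
  rw [Subsingleton.elim a 0, map_zero]

end SingularityCategory

end

/-! ### Transport of the exact sequence to Tor, Ext and the singularity category -/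

open SingularityCategory in
theorem corollary4p4 {R : Type u} [Ring R] [HasDerivedCategory.{w} (ModuleCat.{u} R)]
    (hR : IsLeftCoherent R) (M N : ModuleCat.{u} R)
    (hM : Module.FinitePresentation R M) (hN : Module.FinitePresentation R N) :
    Nonempty (FGProjectiveResolution M) ∧ Nonempty (FGProjectiveResolution N) ∧
    ∀ (P : FGProjectiveResolution M) (Q : FGProjectiveResolution N),
      ∃ (α : ∀ n : ℤ, hyperTor P.rhomDual Q (-n) →+ ExtGroup M N n)
        (β : ∀ n : ℤ, ExtGroup M N n →+ ShiftedHom P.toDSing Q.toDSing n)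
        (δ : ∀ n : ℤ, ShiftedHom P.toDSing Q.toDSing n →+ hyperTor P.rhomDual Q (-(n + 1))),
        (∀ (n : ℤ) (f : ShiftedHom P.toKMinusB Q.toKMinusB n),
          β n (toExtGroup P Q f) = f.map (quotientFunctor R)) ∧
        (∀ n : ℤ, Function.Exact (α n) (β n)) ∧
        (∀ n : ℤ, Function.Exact (β n) (δ n)) ∧
        (∀ n : ℤ, Function.Exact (δ n) (α (n + 1))) ∧
        (∀ n : ℤ, n ≤ -2 → Function.Bijective (δ n)) := by
  refine ⟨⟨(FPModule.mk M hM).resolution hR⟩, ⟨(FPModule.mk N hN).resolution hR⟩, fun P Q => ?_⟩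
  obtain ⟨a, d, h₁, h₂, h₃⟩ :=
    exists_longExactSequence (R := R) P.toKMinusB.property Q.toKMinusB.property
  let T (n : ℤ) := hyperTorEquiv P Q (neg_neg n)
  let E (n : ℤ) := toExtGroupEquiv P Q n
  let S (n : ℤ) := singShiftEquiv P Q n
  let b (n : ℤ) : ShiftedHom P.toKMinusB Q.toKMinusB n →+
      (P.toDSing ⟶ (quotientFunctor R).obj (Q.toKMinusB⟦n⟧)) := (quotientFunctor R).mapAddHom
  let α (n : ℤ) : hyperTor P.rhomDual Q (-n) →+ ExtGroup M N n :=
    ((E n).toAddMonoidHom.comp (a n)).comp (T n).symm.toAddMonoidHom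
  let β (n : ℤ) : ExtGroup M N n →+ ShiftedHom P.toDSing Q.toDSing n :=
    ((S n).toAddMonoidHom.comp (b n)).comp (E n).symm.toAddMonoidHom
  let δ (n : ℤ) : ShiftedHom P.toDSing Q.toDSing n →+ hyperTor P.rhomDual Q (-(n + 1)) :=
    ((T (n + 1)).toAddMonoidHom.comp (d n)).comp (S n).symm.toAddMonoidHom
  have hα (n : ℤ) : (α n).comp (T n).toAddMonoidHom = (E n).toAddMonoidHom.comp (a n) :=
    AddMonoidHom.ext fun x => congr_arg (fun y => E n (a n y)) ((T n).symm_apply_apply x)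
  have hβ (n : ℤ) : (β n).comp (E n).toAddMonoidHom = (S n).toAddMonoidHom.comp (b n) :=
    AddMonoidHom.ext fun x => congr_arg (fun y => S n (b n y)) ((E n).symm_apply_apply x)
  have hδ (n : ℤ) : (δ n).comp (S n).toAddMonoidHom = (T (n + 1)).toAddMonoidHom.comp (d n) :=
    AddMonoidHom.ext fun x => congr_arg (fun y => T (n + 1) (d n y)) ((S n).symm_apply_apply x)
  have hβδ (n : ℤ) : Function.Exact (β n) (δ n) :=
    .of_ladder_addEquiv_of_exact (E n) (S n) (T (n + 1)) (hβ n) (hδ n) (h₂ n)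
  have hδα (n : ℤ) : Function.Exact (δ n) (α (n + 1)) :=
    .of_ladder_addEquiv_of_exact (S n) (T (n + 1)) (E (n + 1)) (hδ n) (hα (n + 1)) (h₃ n)
  refine ⟨α, β, δ, fun n f => DFunLike.congr_fun (hβ n) f, fun n =>
    .of_ladder_addEquiv_of_exact (T n) (E n) (S n) (hα n) (hβ n) (h₁ n), hβδ, hδα,
    fun n hn => ?_⟩
  have := subsingleton_extGroup M N (n := n) (by lia)
  -- The Ext group after the connecting map has degree n + 1, so its vanishing is what requires n ≤
  -- -2 rather than n ≤ -1.
  have := subsingleton_extGroup M N (n := n + 1) (by lia)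
  exact bijective_of_exact_of_subsingleton (hβδ n) (hδα n)
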